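/- Let $H(\mathbb C)$ be the algebra of entire functions with the topology of uniform convergence on compact sets, and let $D$ be complex differentiation on $H(\mathbb C)$. For an entire function $\Phi(z)=\sum_{n\ge 0}a_nz^n$ of exponential type (i.e. there are $M,R>0$ with $|a_n|\le M R^n/n!$ for all $n\ge 0$) let $\Phi(D)f=\sum_{n\ge 0}a_nD^nf$, $f\in H(\mathbb C)$, be the associated convolution operator. A vector $f$ is hypercyclic for $T$ if $\{T^nf:n\ge 0\}$ is dense. A subset $E$ of a commutative topological complex algebra $X$ is called densely strongly algebrable if, for some infinite cardinal $\kappa$, $E\cup\{0\}$ contains a dense (not necessarily unital) subalgebra $A$ of $X$ that is a $\kappa$-generated free algebra, i.e. there is a set $Y\subset A$ of cardinality $\kappa$ such that every map from $Y$ to a commutative algebra $A'$ extends uniquely to an algebra homomorphism $A\to A'$. An arc is a continuous image of an interval of the real line; it is non-trivial if it has more than one point, and strictly convex if each segment with both endpoints in the arc meets the arc only at these endpoints. Let $\mathbb D$ be the open unit disc. (1) The set of common hypercyclic vectors of $\{\sin(kD)\}_{k\ge 1}$ is densely strongly algebrable in $H(\mathbb C)$. (2) More generally, let $(\Phi_n)$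 be any countable family of entire functions of exponential type such that, for each $n$, $\Phi_n(0)\in\mathbb D$ and there is a non-trivial strictly convex arc $\Gamma_n\subset\Phi_n^{-1}(\partial\mathbb D)$ with $$\operatorname{conv}(\Gamma_n\cup\{0\})\setminus\Gamma_n\subset\Phi_n^{-1}(\mathbb D).$$ Then the set of common hypercyclic vectors of the operators $\Phi_n(D)$ is densely strongly algebrable in $H(\mathbb C)$. -/

import Mathlib

open scoped Cardinal

universe u

noncomputable section

/-- The algebra `H(ℂ)` of entire functions. As a subalgebra of `C(ℂ, ℂ)` it carries the
compact-open topology, i.e. the topology of uniform convergence on compact sets. -/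
def entireFunctions : Subalgebra ℂ C(ℂ, ℂ) where
  carrier := {f | Differentiable ℂ (f : ℂ → ℂ)}
  mul_mem' := fun {f g} (hf : Differentiable ℂ f) (hg : Differentiable ℂ g) => hf.mul hg
  add_mem' := fun {f g} (hf : Differentiable ℂ f) (hg : Differentiable ℂ g) => hf.add hg
  algebraMap_mem' := fun c => (differentiable_const c : Differentiable ℂ (fun _ : ℂ => c))

/-- The operator `D` of complex differentiation on `H(ℂ)`. -/
def complexDeriv (f : entireFunctions) : entireFunctions :=
  have hf : Differentiable ℂ (f.1 : ℂ → ℂ) := f.2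
  have hd : Differentiable ℂ (deriv (f.1 : ℂ → ℂ)) :=
    fun z => (hf.analyticAt z).deriv.differentiableAt
  ⟨⟨deriv (f.1 : ℂ → ℂ), hd.continuous⟩, hd⟩

/-- The coefficient `aₙ` of the power series `Φ(z) = ∑ aₙ zⁿ` of an entire function at `0`. -/
def taylorCoeff (Φ : ℂ → ℂ) (n : ℕ) : ℂ :=
  iteratedDeriv n Φ 0 / (n.factorial : ℂ)

/-- `Φ` is an entire function of (finite) exponential type:
`|aₙ| ≤ M Rⁿ / n!` for all `n`, for some `M, R > 0`. -/
def IsEntireOfExponentialType (Φ : ℂ → ℂ) : Prop :=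
  Differentiable ℂ Φ ∧
    ∃ M R : ℝ, 0 < M ∧ 0 < R ∧ ∀ n : ℕ, ‖taylorCoeff Φ n‖ ≤ M * (R ^ n / (n.factorial : ℝ))

/-- The convolution operator `Φ(D) f = ∑ aₙ Dⁿ f` on `H(ℂ)`, the series being summed in `H(ℂ)`.
It converges whenever `Φ` is of exponential type, see `summable_convolutionOperator`. -/
def convolutionOperator (Φ : ℂ → ℂ) (f : entireFunctions) : entireFunctions :=
  ∑' n : ℕ, taylorCoeff Φ n • complexDeriv^[n] f

theorem coe_iterate_complexDeriv (f : entireFunctions) (n : ℕ) :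
    ((complexDeriv^[n] f).1 : ℂ → ℂ) = iteratedDeriv n (f.1 : ℂ → ℂ) := by
  induction n with
  | zero => simp
  | succ n ih =>
    rw [Function.iterate_succ_apply', iteratedDeriv_succ, ← ih]
    rfl

/-- The series defining `Φ(D) f` converges in `H(ℂ)` for `Φ` of exponential type. -/
theorem summable_convolutionOperator (Φ : ℂ → ℂ) (hΦ : IsEntireOfExponentialType Φ)
    (f : entireFunctions) : Summable fun n : ℕ => taylorCoeff Φ n • complexDeriv^[n] f := by
  obtain ⟨-, M, R, hM, hR, hb⟩ := hΦ
  have hs : Summable fun n : ℕ => (taylorCoeff Φ n • complexDeriv^[n] f).1 := by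
    refine ContinuousMap.summable_of_locally_summable_norm fun K => ?_
    obtain ⟨C, hC⟩ := (K.isCompact.cthickening (r := 2 * R)).exists_bound_of_continuousOn
      (f := (f.1 : ℂ → ℂ)) f.1.continuous.continuousOn
    have hg : Summable fun n : ℕ => M * |C| * (1 / 2 : ℝ) ^ n :=
      (summable_geometric_of_lt_one (by norm_num) (by norm_num)).mul_left _
    refine Summable.of_nonneg_of_le (fun _ => norm_nonneg _) (fun n => ?_) hg
    refine (ContinuousMap.norm_le _ (by positivity)).2 fun x => ?_
    have h1 : ‖iteratedDeriv n (f.1 : ℂ → ℂ) x‖ ≤ n.factorial * |C| / (2 * R) ^ n := by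
      refine Complex.norm_iteratedDeriv_le_of_forall_mem_sphere_norm_le n (by positivity)
        (Differentiable.diffContOnCl f.2) fun z hz => ?_
      refine (hC z ?_).trans (le_abs_self C)
      exact Metric.mem_cthickening_of_dist_le z x _ _ x.2 (le_of_eq hz)
    have h2 : ((taylorCoeff Φ n • complexDeriv^[n] f).1.restrict (K : Set ℂ)) x
        = taylorCoeff Φ n * iteratedDeriv n (f.1 : ℂ → ℂ) x := by
      rw [← coe_iterate_complexDeriv]
      rfl
    have hfac : (0 : ℝ) < n.factorial := by exact_mod_cast n.factorial_pos
    rw [h2, norm_mul]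
    refine (mul_le_mul (hb n) h1 (norm_nonneg _) (by positivity)).trans (le_of_eq ?_)
    rw [mul_pow, div_pow, one_pow]
    field_simp
  have hd : Differentiable ℂ ((∑' n : ℕ, (taylorCoeff Φ n • complexDeriv^[n] f).1 : C(ℂ, ℂ)) :
      ℂ → ℂ) := by
    have ht := ContinuousMap.tendsto_iff_tendstoLocallyUniformly.1 hs.hasSum
    refine differentiableOn_univ.1 ((tendstoLocallyUniformlyOn_univ.2 ht).differentiableOn
      (Filter.Eventually.of_forall fun s => ?_) isOpen_univ)
    have h3 := (∑ n ∈ s, taylorCoeff Φ n • complexDeriv^[n] f).2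
    rw [AddSubmonoidClass.coe_finsetSum] at h3
    exact Differentiable.differentiableOn h3
  refine ⟨⟨_, hd⟩, ?_⟩
  have h4 := hs.hasSum
  unfold HasSum at h4 ⊢
  refine tendsto_subtype_rng.2 ?_
  simpa only [AddSubmonoidClass.coe_finsetSum] using h4

/-- `x` is a hypercyclic vector for `T`: its orbit `{Tⁿ x : n ≥ 0}` is dense. -/
def IsHypercyclicVector {X : Type u} [TopologicalSpace X] (T : X → X) (x : X) : Prop :=
  Dense (Set.range fun n : ℕ => T^[n] x)

/-- The set of common hypercyclic vectors of a family of operators. -/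
def commonHypercyclicVectors {ι : Type*} {X : Type u} [TopologicalSpace X] (T : ι → X → X) :
    Set X :=
  {x | ∀ i, IsHypercyclicVector (T i) x}

/-- `Y` is a set of free generators of the commutative (not necessarily unital) complex algebra
`A`: every map from `Y` to a commutative complex algebra extends uniquely to an algebra
homomorphism on `A`. -/
def IsSetOfFreeGenerators {A : Type u} [NonUnitalCommRing A] [Module ℂ A] (Y : Set A) : Prop :=
  ∀ (B : Type u) [NonUnitalCommRing B] [Module ℂ B] [IsScalarTower ℂ B B] [SMulCommClass ℂ B B]
    (g : Y → B), ∃! φ : A →ₙₐ[ℂ] B, ∀ y : Y, φ y = g y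

/-- `E` is densely strongly `κ`-algebrable: `E ∪ {0}` contains a dense subalgebra that is free
on a set of `κ` generators. -/
def IsDenselyStronglyAlgebrableWith {X : Type u} [NonUnitalCommRing X] [Module ℂ X]
    [TopologicalSpace X] (κ : Cardinal.{u}) (E : Set X) : Prop :=
  ∃ A : NonUnitalSubalgebra ℂ X, (A : Set X) ⊆ E ∪ {0} ∧ Dense (A : Set X) ∧
    ∃ Y : Set A, #Y = κ ∧ IsSetOfFreeGenerators Y

/-- `E` is densely strongly algebrable: it is densely strongly `κ`-algebrable for some infinite
cardinal `κ`. -/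
def IsDenselyStronglyAlgebrable {X : Type u} [NonUnitalCommRing X] [Module ℂ X]
    [TopologicalSpace X] (E : Set X) : Prop :=
  ∃ κ : Cardinal.{u}, ℵ₀ ≤ κ ∧ IsDenselyStronglyAlgebrableWith κ E

/-- `Γ` is a non-trivial (more than one point) planar arc: a continuous image of an interval of
the real line. Neither compactness nor simplicity is required. -/
def IsNontrivialArc (Γ : Set ℂ) : Prop :=
  Γ.Nontrivial ∧ ∃ (I : Set ℝ) (γ : ℝ → ℂ), I.OrdConnected ∧ ContinuousOn γ I ∧ γ '' I = Γ

/-- Strict convexity of an arc: each segment with both endpoints in `Γ` meets `Γ` only at these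
endpoints. -/
def IsStrictlyConvexArc (Γ : Set ℂ) : Prop :=
  ∀ a ∈ Γ, ∀ b ∈ Γ, segment ℝ a b ∩ Γ ⊆ {a, b}

end

open Filter Topology

/-! Exponentials are eigenvectors, `Φ(D) e^{λz} = Φ(λ) e^{λz}`, and products of exponentials are
exponentials, so the iterates of `Φ(D)` act explicitly on polynomials in exponential sums.

By Baire's theorem in `H(ℂ)^ℕ`, a generic sequence `f` has dense range, and every nonzero polynomial
in its terms without constant term is hypercyclic for all the operators
(`isDenselyStronglyAlgebrable_of_nonempty`). Such polynomials are in particular nonzero, so the `f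
n` freely generate a dense algebra (`isSetOfFreeGenerators_range`).

Genericity rests on a transitivity property (`exists_mem_pow_monomials_mem`). Let `β`, of degree
`m`, be the leading exponent of a finite set `A`. Close to a given `u` one needs `f` and `q` with
`Φ(D)^q f^β` close to `∑ b_j e^{l_j z}` and `Φ(D)^q f^α` close to `0` for the other `α ∈ A`. Take
`f_i = u_i + ∑_j a_j Φ(l_j)^{-q x_i} e^{l_j z / m}` with `a_j^m = b_j`, `|Φ(l_j)| > 1` and `x_i >
0`, where `u_i` has small frequencies. In the expansion of `f^α`, the `m`-th power of a single
exponential acquires the coefficient `a_j^m Φ(l_j)^{q (1 - ∑ α_i x_i)}`: it is `b_j` if `α` has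
weight `1`, and tends to `0` if the weight exceeds `1`. All other terms have frequencies where `|Φ|
< 1` and die out.

The weights `x` come from `exists_leading_exponent`. The frequencies come from the arc: by strict
convexity, infinitely many of its points have all their nontrivial combinations with the origin
inside `|Φ| < 1` (`exists_infinite_isBounded_subset`), and exponentials with such frequencies span a
dense subspace (`dense_span_expFun`). -/

/-! ### Topology of `H(ℂ)` -/

instance : IsTopologicalRing entireFunctions where
  continuous_add := Continuous.subtype_mk ((continuous_subtype_val.comp continuous_fst).add
    (continuous_subtype_val.comp continuous_snd)) _
  continuous_mul := Continuous.subtype_mk ((continuous_subtype_val.comp continuous_fst).mul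
    (continuous_subtype_val.comp continuous_snd)) _
  continuous_neg := Continuous.subtype_mk continuous_subtype_val.neg _

instance : IsTopologicalAddGroup entireFunctions where
  continuous_add := continuous_add
  continuous_neg := Continuous.subtype_mk continuous_subtype_val.neg _

instance : SecondCountableTopology entireFunctions :=
  IsEmbedding.subtypeVal.secondCountableTopology

theorem isClosed_entireFunctions : IsClosed (entireFunctions : Set C(ℂ, ℂ)) := by
  refine isClosed_of_closure_subset fun f hf => ?_
  obtain ⟨u, hu, hf⟩ := mem_closure_iff_seq_limit.1 hf
  have ht := ContinuousMap.tendsto_iff_tendstoLocallyUniformly.1 hf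
  exact differentiableOn_univ.1 ((tendstoLocallyUniformlyOn_univ.2 ht).differentiableOn
    (Eventually.of_forall fun n => Differentiable.differentiableOn (hu n)) isOpen_univ)

instance : CompleteSpace entireFunctions :=
  isClosed_entireFunctions.completeSpace_coe

instance : (uniformity entireFunctions).IsCountablyGenerated :=
  Filter.comap.isCountablyGenerated _ _

instance : BaireSpace (ℕ → entireFunctions) :=
  inferInstance

theorem entireFunctions_tendsto_iff {ι : Type*} {l : Filter ι} {F : ι → entireFunctions}
    {f : entireFunctions} :
    Tendsto F l (𝓝 f) ↔
      ∀ K : Set ℂ, IsCompact K → ∀ ε > 0, ∀ᶠ i in l, ∀ x ∈ K, ‖(F i).1 x - f.1 x‖ < ε := by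
  rw [tendsto_subtype_rng, ContinuousMap.tendsto_iff_forall_isCompact_tendstoUniformlyOn]
  simp only [Metric.tendstoUniformlyOn_iff, dist_comm (f.1 _), dist_eq_norm]

/-! ### Exponentials as eigenvectors, and continuity of `Φ(D)` -/

/-- The entire function `z ↦ exp (l * z)`. -/
noncomputable def expFun (l : ℂ) : entireFunctions :=
  ⟨⟨fun z => Complex.exp (l * z), by fun_prop⟩,
    show Differentiable ℂ fun z => Complex.exp (l * z) by fun_prop⟩

@[simp] theorem expFun_apply (l z : ℂ) : (expFun l).1 z = Complex.exp (l * z) := rfl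

theorem entireFunctions_ext {f g : entireFunctions} (h : ∀ z, f.1 z = g.1 z) : f = g :=
  Subtype.ext (ContinuousMap.ext h)

theorem expFun_zero : expFun 0 = 1 := entireFunctions_ext fun z => by simp

theorem expFun_add (a b : ℂ) : expFun (a + b) = expFun a * expFun b :=
  entireFunctions_ext fun z => by simp [add_mul, Complex.exp_add]

theorem expFun_sum {ι : Type*} (s : Finset ι) (f : ι → ℂ) :
    expFun (∑ i ∈ s, f i) = ∏ i ∈ s, expFun (f i) := by
  classical
  induction s using Finset.induction_on with
  | empty => simp [expFun_zero]
  | insert a s ha ih => rw [Finset.sum_insert ha, Finset.prod_insert ha, expFun_add, ih]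

theorem continuous_expFun : Continuous expFun := by
  refine Continuous.subtype_mk (ContinuousMap.continuous_of_continuous_uncurry _ ?_) _
  exact Complex.continuous_exp.comp (continuous_fst.mul continuous_snd)

theorem complexDeriv_iterate_apply (f : entireFunctions) (n : ℕ) (z : ℂ) :
    (complexDeriv^[n] f).1 z = iteratedDeriv n (f.1 : ℂ → ℂ) z := by
  rw [← coe_iterate_complexDeriv]

theorem complexDeriv_iterate_add (n : ℕ) (f g : entireFunctions) :
    complexDeriv^[n] (f + g) = complexDeriv^[n] f + complexDeriv^[n] g := by
  refine Function.Semiconj₂.iterate (f := complexDeriv) (op := (· + ·)) (fun f g => ?_) n f g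
  exact entireFunctions_ext fun z =>
    deriv_add (Differentiable.differentiableAt f.2) (Differentiable.differentiableAt g.2)

theorem complexDeriv_iterate_smul (n : ℕ) (c : ℂ) (f : entireFunctions) :
    complexDeriv^[n] (c • f) = c • complexDeriv^[n] f := by
  refine (Function.Commute.iterate_left (f := complexDeriv) (g := (c • ·)) (fun f => ?_) n) f
  exact entireFunctions_ext fun z => deriv_const_smul c (Differentiable.differentiableAt f.2)

theorem complexDeriv_iterate_expFun (n : ℕ) (l : ℂ) :
    complexDeriv^[n] (expFun l) = l ^ n • expFun l := by
  refine entireFunctions_ext fun z => ?_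
  rw [complexDeriv_iterate_apply]
  exact congrFun (iteratedDeriv_cexp_const_mul n l) z

/-- The convolution operator `Φ(D)` as a linear map. -/
noncomputable def convolutionLinearMap (Φ : ℂ → ℂ) (hΦ : IsEntireOfExponentialType Φ) :
    entireFunctions →ₗ[ℂ] entireFunctions where
  toFun := convolutionOperator Φ
  map_add' f g := by
    unfold convolutionOperator
    rw [← (summable_convolutionOperator Φ hΦ f).tsum_add (summable_convolutionOperator Φ hΦ g)]
    simp_rw [complexDeriv_iterate_add, smul_add]
  map_smul' c f := by
    unfold convolutionOperator
    simp only [complexDeriv_iterate_smul, RingHom.id_apply]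
    rw [← (summable_convolutionOperator Φ hΦ f).tsum_const_smul]
    simp_rw [smul_comm c]

theorem hasSum_convolutionOperator_apply {Φ : ℂ → ℂ} (hΦ : IsEntireOfExponentialType Φ)
    (f : entireFunctions) (z : ℂ) :
    HasSum (fun n => taylorCoeff Φ n * iteratedDeriv n (f.1 : ℂ → ℂ) z)
      ((convolutionOperator Φ f).1 z) := by
  have h := (summable_convolutionOperator Φ hΦ f).hasSum
  let ev : entireFunctions →+ ℂ :=
    { toFun := fun f => f.1 z, map_zero' := rfl, map_add' := fun _ _ => rfl }
  have hev : Continuous ev := (ContinuousEvalConst.continuous_eval_const z).comp continuous_subtype_val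
  have h2 := h.map ev hev
  refine h2.congr_fun fun n => ?_
  rw [← complexDeriv_iterate_apply]
  rfl

theorem hasSum_taylorCoeff {Φ : ℂ → ℂ} (hΦ : Differentiable ℂ Φ) (z : ℂ) :
    HasSum (fun n => taylorCoeff Φ n * z ^ n) (Φ z) := by
  have h := Complex.hasSum_taylorSeries_of_entire hΦ 0 z
  simp only [sub_zero, smul_eq_mul] at h
  refine h.congr_fun fun n => ?_
  rw [taylorCoeff]; ring

theorem convolutionOperator_expFun {Φ : ℂ → ℂ} (hΦ : IsEntireOfExponentialType Φ) (l : ℂ) :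
    convolutionOperator Φ (expFun l) = Φ l • expFun l := by
  refine entireFunctions_ext fun z => ?_
  refine (hasSum_convolutionOperator_apply hΦ (expFun l) z).unique ?_
  refine ((hasSum_taylorCoeff hΦ.1 l).mul_right (Complex.exp (l * z))).congr_fun fun n => ?_
  rw [← complexDeriv_iterate_apply, complexDeriv_iterate_expFun, mul_assoc]
  rfl

/-- Cauchy's estimate on a circle of radius `2R` bounds the `n`-th term by `M C 2⁻ⁿ`; this yields
continuity of `Φ(D)`. -/
theorem norm_convolutionOperator_apply_le {Φ : ℂ → ℂ} {M R : ℝ} (hM : 0 < M) (hR : 0 < R)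
    (hΦ : Differentiable ℂ Φ)
    (hb : ∀ n : ℕ, ‖taylorCoeff Φ n‖ ≤ M * (R ^ n / (n.factorial : ℝ))) (f : entireFunctions)
    (z : ℂ) {C : ℝ} (hC : ∀ w ∈ Metric.sphere z (2 * R), ‖f.1 w‖ ≤ C) :
    ‖(convolutionOperator Φ f).1 z‖ ≤ M * C * 2 := by
  refine (hasSum_convolutionOperator_apply ⟨hΦ, M, R, hM, hR, hb⟩ f z).norm_le_of_bounded
    (hasSum_geometric_two.mul_left (M * C)) fun n => ?_
  have h1 : ‖iteratedDeriv n (f.1 : ℂ → ℂ) z‖ ≤ n.factorial * C / (2 * R) ^ n :=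
    Complex.norm_iteratedDeriv_le_of_forall_mem_sphere_norm_le n (by positivity)
      (Differentiable.diffContOnCl f.2) hC
  have hfac : (0 : ℝ) < n.factorial := by exact_mod_cast n.factorial_pos
  rw [norm_mul]
  refine (mul_le_mul (hb n) h1 (norm_nonneg _) (by positivity)).trans (le_of_eq ?_)
  rw [mul_pow, div_pow, one_pow]
  field_simp

theorem continuous_convolutionLinearMap {Φ : ℂ → ℂ} (hΦ : IsEntireOfExponentialType Φ) :
    Continuous (convolutionLinearMap Φ hΦ) := by
  refine continuous_of_continuousAt_zero (convolutionLinearMap Φ hΦ) ?_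
  obtain ⟨hd, M, R, hM, hR, hb⟩ := hΦ
  have h0 := entireFunctions_tendsto_iff.1 (tendsto_id (x := 𝓝 (0 : entireFunctions)))
  rw [ContinuousAt, map_zero, entireFunctions_tendsto_iff]
  intro K hK ε hε
  filter_upwards [h0 _ (hK.cthickening (r := 2 * R)) (ε / (4 * M)) (by positivity)] with f hf z hz
  have := norm_convolutionOperator_apply_le hM hR hd hb f z (C := ε / (4 * M)) fun w hw => by
    have := hf w (Metric.mem_cthickening_of_dist_le w z _ _ hz (le_of_eq hw))
    simpa using this.le
  have h2 : M * (ε / (4 * M)) * 2 = ε / 2 := by field_simp; norm_num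
  rw [h2] at this
  change ‖(convolutionOperator Φ f).1 z - 0‖ < ε
  rw [sub_zero]
  exact this.trans_lt (half_lt_self hε)

/-! ### Density of spans of exponentials -/

theorem hasSum_taylorCoeff_smul_pow {f : C(ℂ, ℂ)} (hf : Differentiable ℂ f) :
    HasSum (fun n => taylorCoeff f n • (ContinuousMap.id ℂ) ^ n) f := by
  have hs : Summable fun n => taylorCoeff f n • (ContinuousMap.id ℂ) ^ n := by
    refine ContinuousMap.summable_of_locally_summable_norm fun K => ?_
    obtain ⟨R, hR, hK⟩ := K.isCompact.isBounded.exists_pos_norm_le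
    obtain ⟨C, hC⟩ := (isCompact_closedBall (0 : ℂ) (2 * R)).exists_bound_of_continuousOn
      (f := f) f.continuous.continuousOn
    refine Summable.of_nonneg_of_le (fun _ => norm_nonneg _) (fun n => ?_)
      (summable_geometric_two.mul_left |C|)
    refine (ContinuousMap.norm_le _ (by positivity)).2 fun x => ?_
    have h1 : ‖iteratedDeriv n f 0‖ ≤ n.factorial * |C| / (2 * R) ^ n :=
      Complex.norm_iteratedDeriv_le_of_forall_mem_sphere_norm_le n (by positivity)
        hf.diffContOnCl fun z hz =>
          (hC z (Metric.sphere_subset_closedBall hz)).trans (le_abs_self C)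
    have h2 : ((taylorCoeff f n • (ContinuousMap.id ℂ) ^ n : C(ℂ, ℂ)).restrict (K : Set ℂ)) x
        = taylorCoeff f n * (x : ℂ) ^ n := rfl
    have hfac : (0 : ℝ) < n.factorial := by exact_mod_cast n.factorial_pos
    have h3 : ‖taylorCoeff f n‖ ≤ |C| / (2 * R) ^ n := by
      rw [taylorCoeff, norm_div, Complex.norm_natCast, div_le_iff₀ hfac]
      exact h1.trans (le_of_eq (by ring))
    rw [h2, norm_mul, norm_pow]
    refine (mul_le_mul h3 (pow_le_pow_left₀ (norm_nonneg _) (hK x x.2) n) (by positivity)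
      (by positivity)).trans (le_of_eq ?_)
    rw [mul_pow, div_pow, one_pow]
    field_simp
  convert hs.hasSum
  ext z
  exact (hasSum_taylorCoeff hf z).unique (ContinuousMap.hasSum_apply hs.hasSum z)

theorem taylorCoeff_expFun (l : ℂ) (n : ℕ) :
    taylorCoeff (expFun l).1 n = l ^ n / n.factorial := by
  rw [taylorCoeff, ← coe_iterate_complexDeriv, complexDeriv_iterate_expFun]
  congr 1
  change l ^ n * Complex.exp (l * 0) = _
  simp

/-- An everywhere convergent power series whose sum vanishes on an infinite bounded set is zero. -/
theorem coeff_eq_zero_of_infinite_zeros {c : ℕ → ℂ} {g : ℂ → ℂ}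
    (hg : ∀ z, HasSum (fun n => z ^ n * c n) (g z)) {S : Set ℂ} (hS : S.Infinite)
    (hb : Bornology.IsBounded S) (h0 : ∀ z ∈ S, g z = 0) (n : ℕ) : c n = 0 := by
  let p := FormalMultilinearSeries.ofScalars ℂ c
  have hrad : p.radius = ⊤ := by
    refine FormalMultilinearSeries.radius_eq_top_of_summable_norm _ fun r => ?_
    refine (hg r).summable.norm.congr fun n => ?_
    simp [p, mul_comm]
  have hp : HasFPowerSeriesOnBall g p 0 ⊤ := by
    have h := p.hasFPowerSeriesOnBall (by simp [hrad])
    rw [hrad] at h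
    refine h.congr fun z _ => ?_
    rw [FormalMultilinearSeries.sum, ← (hg z).tsum_eq]
    refine tsum_congr fun n => ?_
    simp [p, mul_comm]
  have han : AnalyticOnNhd ℂ g Set.univ := by
    have := hp.analyticOnNhd
    simpa using this
  obtain ⟨x, -, hx⟩ := hS.exists_accPt_of_subset_isCompact hb.isCompact_closure subset_closure
  have hz := han.eqOn_zero_of_preconnected_of_frequently_eq_zero isPreconnected_univ
    (Set.mem_univ x) ((accPt_iff_frequently_nhdsNE.1 hx).mono h0)
  have hg0 : g = 0 := funext fun z => hz (Set.mem_univ z)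
  have hp0 : p = 0 := (hg0 ▸ hp.hasFPowerSeriesAt).eq_zero
  exact congrFun ((FormalMultilinearSeries.ofScalars_series_eq_zero (𝕜 := ℂ) ℂ).1 hp0) n

/-- If a functional `φ` kills `e^{lz}` for all `l ∈ S`, the entire function `l ↦ φ(e^{lz})` vanishes
on a set with an accumulation point. Its Taylor coefficients `φ(zⁿ)/n!` are then zero, so `φ` kills
every entire function; Hahn–Banach concludes. -/
theorem dense_span_expFun {S : Set ℂ} (hS : S.Infinite) (hb : Bornology.IsBounded S) :
    Dense (Submodule.span ℂ (expFun '' S) : Set entireFunctions) := by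
  intro f
  rw [closure_subtype]
  by_contra hf
  set p : Submodule ℂ C(ℂ, ℂ) :=
    (Submodule.span ℂ ((fun l => (expFun l).1) '' S)).topologicalClosure
  have hfp : f.1 ∉ (p : Set C(ℂ, ℂ)) := by
    refine fun h => hf ?_
    convert h
    rw [Submodule.topologicalClosure_coe, ← Set.image_image Subtype.val expFun S]
    exact congrArg closure (congrArg SetLike.coe
      (Submodule.map_span entireFunctions.val.toLinearMap (expFun '' S)))
  obtain ⟨φ, u, h1, h2⟩ := RCLike.geometric_hahn_banach_closed_point (𝕜 := ℂ)
    (p.restrictScalars ℝ).convex (Submodule.isClosed_topologicalClosure _) hfp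
  have hφ : ∀ a ∈ p, φ a = 0 := by
    intro a ha
    by_contra hne
    -- This multiple of `a` has `φ`-value `|u| + 1`, beyond the separating bound `u`.
    have := h1 ((((|u| + 1 : ℝ) : ℂ) / φ a) • a) (p.smul_mem _ ha)
    rw [map_smul, smul_eq_mul, div_mul_cancel₀ _ hne] at this
    have h3 : (|u| + 1 : ℝ) < u := by simpa using this
    linarith [le_abs_self u]
  have hc := coeff_eq_zero_of_infinite_zeros (c := fun n => φ ((ContinuousMap.id ℂ) ^ n) / n.factorial)
    (g := fun l => φ (expFun l).1) (fun l => ?_) hS hb fun l hl => hφ _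
      (subset_closure (Submodule.subset_span ⟨l, hl, rfl⟩))
  · have h3 := (hasSum_taylorCoeff_smul_pow f.2).map φ φ.continuous
    have h4 : φ f.1 = 0 := by
      refine h3.unique ?_
      convert hasSum_zero using 1
      ext n
      have := hc n
      have hfac : (n.factorial : ℂ) ≠ 0 := by exact_mod_cast n.factorial_ne_zero
      simp only [div_eq_zero_iff, hfac, or_false] at this
      simp [this]
    have h5 := h1 0 p.zero_mem
    simp [h4] at h2 h5
    linarith
  · have h3 := (hasSum_taylorCoeff_smul_pow (expFun l).2).map φ φ.continuous
    refine h3.congr_fun fun n => ?_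
    simp only [Function.comp_apply, map_smul, taylorCoeff_expFun, smul_eq_mul]
    ring

/-! ### Planar geometry of the arc -/

/-- Maximum modulus: a local maximum of `|Φ|` would make `Φ` constant, contradicting `|Φ(0)| < 1`.
-/
theorem not_eventually_norm_le_one {Φ : ℂ → ℂ} (hΦ : Differentiable ℂ Φ) (h0 : ‖Φ 0‖ < 1) {x : ℂ}
    (hx : ‖Φ x‖ = 1) : ¬ ∀ᶠ z in 𝓝 x, ‖Φ z‖ ≤ 1 := by
  intro h
  have h1 : IsLocalMax (norm ∘ Φ) x := h.mono fun z hz => by simpa [hx] using hz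
  have h2 := Complex.eventually_eq_of_isLocalMax_norm (Eventually.of_forall hΦ) h1
  have h3 : Φ = fun _ => Φ x := AnalyticOnNhd.eq_of_eventuallyEq
    (fun z _ => hΦ.analyticAt z) (fun z _ => analyticAt_const) h2
  rw [h3, hx] at h0
  exact lt_irrefl _ h0

theorem strongDual_complex_apply (f : StrongDual ℝ ℂ) (z : ℂ) :
    f z = z.re * f 1 + z.im * f Complex.I := by
  conv_lhs => rw [← Complex.re_add_im z]
  rw [map_add]
  congr 1
  · simpa using f.map_smul z.re 1
  · simpa using f.map_smul z.im Complex.I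

theorem collinear_of_apply_eq {f : StrongDual ℝ ℂ} (hf : f ≠ 0) {s : Set ℂ} {r : ℝ}
    (hs : ∀ z ∈ s, f z = r) : Collinear ℝ s := by
  rcases s.eq_empty_or_nonempty with rfl | ⟨p, hp⟩
  · exact collinear_empty ℝ ℂ
  have hpos : 0 < f 1 ^ 2 + f Complex.I ^ 2 := by
    by_contra hle
    have h1 : f 1 = 0 := by nlinarith [sq_nonneg (f 1), sq_nonneg (f Complex.I)]
    have h2 : f Complex.I = 0 := by nlinarith [sq_nonneg (f 1), sq_nonneg (f Complex.I)]
    exact hf (ContinuousLinearMap.ext fun z => by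
      rw [strongDual_complex_apply, h1, h2]; simp)
  refine (collinear_iff_of_mem hp).2 ⟨⟨-f Complex.I, f 1⟩, fun z hz => ?_⟩
  refine ⟨(-f Complex.I * (z.re - p.re) + f 1 * (z.im - p.im)) / (f 1 ^ 2 + f Complex.I ^ 2), ?_⟩
  have h := (hs z hz).trans (hs p hp).symm
  rw [strongDual_complex_apply, strongDual_complex_apply f p] at h
  refine Complex.ext ?_ ?_
  · simp only [vadd_eq_add, Complex.add_re, Complex.smul_re, smul_eq_mul]
    field_simp
    linear_combination (f 1) * h
  · simp only [vadd_eq_add, Complex.add_im, Complex.smul_im, smul_eq_mul]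
    field_simp
    linear_combination (f Complex.I) * h

theorem exists_eq_mul_det_of_apply_eq_zero {f : StrongDual ℝ ℂ} {l : ℂ} (hl : l ≠ 0)
    (h : f l = 0) : ∃ k : ℝ, ∀ z, f z = k * (l.re * z.im - l.im * z.re) := by
  have hpos : l.re ^ 2 + l.im ^ 2 ≠ 0 := by
    have := Complex.normSq_pos.2 hl
    rw [Complex.normSq_apply] at this
    nlinarith
  refine ⟨(f Complex.I * l.re - f 1 * l.im) / (l.re ^ 2 + l.im ^ 2), fun z => ?_⟩
  rw [strongDual_complex_apply] at h ⊢
  field_simp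
  linear_combination (l.re * z.re + l.im * z.im) * h

namespace IsStrictlyConvexArc

variable {Γ : Set ℂ}

/-- Of three collinear points one lies between the other two. -/
theorem not_collinear (hΓ : IsStrictlyConvexArc Γ) {a b c : ℂ} (ha : a ∈ Γ) (hb : b ∈ Γ)
    (hc : c ∈ Γ) (hab : a ≠ b) (hac : a ≠ c) (hbc : b ≠ c) : ¬ Collinear ℝ {a, b, c} := by
  intro h
  rcases h.wbtw_or_wbtw_or_wbtw with h | h | h
  · have := hΓ a ha c hc ⟨mem_segment_iff_wbtw.2 h, hb⟩
    grind
  · have := hΓ b hb a ha ⟨mem_segment_iff_wbtw.2 h, hc⟩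
    grind
  · have := hΓ c hc b hb ⟨mem_segment_iff_wbtw.2 h, ha⟩
    grind

theorem finite_of_collinear (hΓ : IsStrictlyConvexArc Γ) {s : Set ℂ} (hs : s ⊆ Γ)
    (hcol : Collinear ℝ s) : s.Finite := by
  by_contra hinf
  obtain ⟨a, ha⟩ := Set.Infinite.nonempty hinf
  obtain ⟨b, hb, hab⟩ := (Set.Infinite.sdiff hinf (Set.finite_singleton a)).nonempty
  obtain ⟨c, hc, hcc⟩ := (Set.Infinite.sdiff hinf (Set.toFinite {a, b})).nonempty
  simp only [Set.mem_singleton_iff, Set.mem_insert_iff, not_or] at hab hcc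
  refine hΓ.not_collinear (hs ha) (hs hb) (hs hc) (Ne.symm hab) (Ne.symm hcc.1) (Ne.symm hcc.2)
    (hcol.subset ?_)
  rintro x (rfl | rfl | rfl) <;> assumption

theorem interior_nonempty (hΓ : IsStrictlyConvexArc Γ) (hinf : Γ.Infinite) :
    (interior (convexHull ℝ (Γ ∪ {0}))).Nonempty := by
  obtain ⟨a, ha⟩ := hinf.nonempty
  obtain ⟨b, hb, hab⟩ := (hinf.sdiff (Set.finite_singleton a)).nonempty
  obtain ⟨c, hc, hcc⟩ := (hinf.sdiff (Set.toFinite {a, b})).nonempty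
  simp only [Set.mem_singleton_iff, Set.mem_insert_iff, not_or] at hab hcc
  have hn := hΓ.not_collinear ha hb hc (Ne.symm hab) (Ne.symm hcc.1) (Ne.symm hcc.2)
  have hai := affineIndependent_iff_not_collinear_set.2 hn
  have htop := hai.affineSpan_eq_top_iff_card_eq_finrank_add_one.2 (by simp)
  refine interior_convexHull_nonempty_iff_affineSpan_eq_top.2 (top_le_iff.1 ?_)
  rw [← htop]
  refine affineSpan_mono ℝ ?_
  rintro _ ⟨i, rfl⟩
  fin_cases i <;> simp [ha, hb, hc]

end IsStrictlyConvexArc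

/-- A convex set on which `|Φ| ≤ 1` has a supporting functional at each point where `|Φ| = 1`. -/
theorem exists_supporting_functional {Φ : ℂ → ℂ} (hΦ : Differentiable ℂ Φ) (h0 : ‖Φ 0‖ < 1)
    {K : Set ℂ} (hK : Convex ℝ K) (hint : (interior K).Nonempty) (hle : ∀ z ∈ K, ‖Φ z‖ ≤ 1)
    {x : ℂ} (hx : ‖Φ x‖ = 1) : ∃ f : StrongDual ℝ ℂ, f ≠ 0 ∧ ∀ y ∈ K, f y ≤ f x := by
  have hxi : x ∉ interior K := fun hxi =>
    not_eventually_norm_le_one hΦ h0 hx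
      (Filter.mem_of_superset (mem_interior_iff_mem_nhds.1 hxi) hle)
  obtain ⟨f, hf⟩ := geometric_hahn_banach_open_point hK.interior isOpen_interior hxi
  refine ⟨f, ?_, fun y hy => ?_⟩
  · rintro rfl
    obtain ⟨y, hy⟩ := hint
    simpa using hf y hy
  · have hy' : y ∈ closure (interior K) := by
      rw [hK.closure_interior_eq_closure_of_nonempty_interior hint]
      exact subset_closure hy
    exact closure_minimal (fun z hz => (hf z hz).le)
      (isClosed_le f.continuous continuous_const) hy'

/-- The points of `Γ` that are not hidden from the origin by other points of `Γ`. -/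
def visiblePoints (Γ : Set ℂ) : Set ℂ :=
  {l ∈ Γ | ∀ t : ℝ, 0 ≤ t → t < 1 → (t : ℂ) * l ∉ Γ}

section Arc

variable {Φ : ℂ → ℂ} {Γ : Set ℂ}

theorem norm_le_one_of_mem_convexHull (hsub : Γ ⊆ Φ ⁻¹' Metric.sphere (0 : ℂ) 1)
    (hhull : convexHull ℝ (Γ ∪ {0}) \ Γ ⊆ Φ ⁻¹' Metric.ball (0 : ℂ) 1) {z : ℂ}
    (hz : z ∈ convexHull ℝ (Γ ∪ {0})) : ‖Φ z‖ ≤ 1 := by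
  by_cases h : z ∈ Γ
  · simpa using (hsub h).le
  · simpa using (mem_ball_zero_iff.1 (hhull ⟨hz, h⟩)).le

/-- If `l` is hidden by `tl ∈ Γ`, a supporting functional at `tl` must vanish at `l`, since both `0`
and `l` lie in the hull; so `Γ` lies on one side of the line `ℝl`. Each line carries finitely many
points of `Γ`, so infinitely many hidden points would give three of them on distinct lines through
`0`, each line having the other two points on one side. The signs of their pairwise determinants
forbid this. -/
theorem finite_diff_visiblePoints (hΦ : Differentiable ℂ Φ) (h0 : ‖Φ 0‖ < 1)
    (hconv : IsStrictlyConvexArc Γ) (hinf : Γ.Infinite)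
    (hsub : Γ ⊆ Φ ⁻¹' Metric.sphere (0 : ℂ) 1)
    (hhull : convexHull ℝ (Γ ∪ {0}) \ Γ ⊆ Φ ⁻¹' Metric.ball (0 : ℂ) 1) :
    (Γ \ visiblePoints Γ).Finite := by
  have h0Γ : (0 : ℂ) ∉ Γ := fun h => by
    have := hsub h
    simp at this
    exact h0.ne this
  have key : ∀ l ∈ Γ \ visiblePoints Γ, ∃ f : StrongDual ℝ ℂ, f ≠ 0 ∧ f l = 0 ∧
      ∀ y ∈ Γ, f y ≤ 0 := by
    rintro l ⟨hl, hn⟩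
    simp only [visiblePoints, Set.mem_ofPred_eq, not_and, not_forall, not_not] at hn
    obtain ⟨t, ht0, ht1, ht⟩ := hn hl
    have htpos : 0 < t := ht0.lt_of_ne fun h => h0Γ (by simpa [← h] using ht)
    obtain ⟨f, hf, hmax⟩ := exists_supporting_functional hΦ h0 (convex_convexHull ℝ _)
      (hconv.interior_nonempty hinf) (fun z => norm_le_one_of_mem_convexHull hsub hhull)
      (x := t * l) (by simpa using hsub ht)
    have h1 := hmax 0 (subset_convexHull ℝ _ (by simp))
    have h2 := hmax l (subset_convexHull ℝ _ (by simp [hl]))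
    have h3 : f (t * l) = t * f l := by simpa using f.map_smul t l
    rw [h3, map_zero] at h1
    rw [h3] at h2
    have h4 : f l = 0 := by nlinarith
    refine ⟨f, hf, h4, fun y hy => ?_⟩
    simpa [h3, h4] using hmax y (subset_convexHull ℝ _ (by simp [hy]))
  have hfin : ∀ f : StrongDual ℝ ℂ, f ≠ 0 → {z ∈ Γ | f z = 0}.Finite := fun f hf =>
    hconv.finite_of_collinear (fun z hz => hz.1) (collinear_of_apply_eq hf fun z hz => hz.2)
  by_contra hN
  obtain ⟨l₁, h₁⟩ := Set.Infinite.nonempty hN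
  obtain ⟨f₁, hf₁, hz₁, hm₁⟩ := key l₁ h₁
  obtain ⟨l₂, h₂, hn₂⟩ := (Set.Infinite.sdiff hN (hfin f₁ hf₁)).nonempty
  obtain ⟨f₂, hf₂, hz₂, hm₂⟩ := key l₂ h₂
  obtain ⟨l₃, h₃, hn₃⟩ := (Set.Infinite.sdiff hN ((hfin f₁ hf₁).union (hfin f₂ hf₂))).nonempty
  obtain ⟨f₃, hf₃, hz₃, hm₃⟩ := key l₃ h₃
  have hne : ∀ l ∈ Γ, l ≠ 0 := fun l hl h => h0Γ (h ▸ hl)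
  obtain ⟨k₁, hk₁⟩ := exists_eq_mul_det_of_apply_eq_zero (hne l₁ h₁.1) hz₁
  obtain ⟨k₂, hk₂⟩ := exists_eq_mul_det_of_apply_eq_zero (hne l₂ h₂.1) hz₂
  obtain ⟨k₃, hk₃⟩ := exists_eq_mul_det_of_apply_eq_zero (hne l₃ h₃.1) hz₃
  have hk₃0 : k₃ ≠ 0 := fun h => hf₃ (ContinuousLinearMap.ext fun z => by simp [hk₃, h])
  have e₁₂ : f₁ l₂ < 0 := (hm₁ _ h₂.1).lt_of_ne fun h => hn₂ ⟨h₂.1, h⟩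
  have e₁₃ : f₁ l₃ < 0 := (hm₁ _ h₃.1).lt_of_ne fun h => hn₃ (Or.inl ⟨h₃.1, h⟩)
  have e₂₃ : f₂ l₃ < 0 := (hm₂ _ h₃.1).lt_of_ne fun h => hn₃ (Or.inr ⟨h₃.1, h⟩)
  have e₂₁ := hm₂ _ h₁.1
  have e₃₁ := hm₃ _ h₁.1
  have e₃₂ := hm₃ _ h₂.1
  rw [hk₁] at e₁₂ e₁₃
  rw [hk₂] at e₂₃ e₂₁
  rw [hk₃] at e₃₁ e₃₂
  obtain ⟨A, hA⟩ : ∃ A, A = l₁.re * l₂.im - l₁.im * l₂.re := ⟨_, rfl⟩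
  obtain ⟨B, hB⟩ : ∃ B, B = l₂.re * l₃.im - l₂.im * l₃.re := ⟨_, rfl⟩
  obtain ⟨C, hC⟩ : ∃ C, C = l₃.re * l₁.im - l₃.im * l₁.re := ⟨_, rfl⟩
  have hA' : l₂.re * l₁.im - l₂.im * l₁.re = -A := by rw [hA]; ring
  have hB' : l₃.re * l₂.im - l₃.im * l₂.re = -B := by rw [hB]; ring
  have hC' : l₁.re * l₃.im - l₁.im * l₃.re = -C := by rw [hC]; ring
  rw [← hA] at e₁₂
  rw [hC'] at e₁₃
  rw [← hB] at e₂₃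
  rw [hA'] at e₂₁
  rw [← hC] at e₃₁
  rw [hB'] at e₃₂
  have hAC : A * C < 0 := by
    by_contra h
    nlinarith [mul_pos_of_neg_of_neg e₁₂ e₁₃, mul_nonneg (sq_nonneg k₁) (not_lt.1 h)]
  have hAB : A * B ≤ 0 := by
    have hk2 : 0 < k₂ ^ 2 := by
      refine lt_of_le_of_ne (sq_nonneg _) fun h => ?_
      rw [pow_eq_zero_iff two_ne_zero |>.1 h.symm] at e₂₃
      simp at e₂₃
    by_contra h
    nlinarith [mul_nonneg_of_nonpos_of_nonpos e₂₃.le e₂₁, mul_pos hk2 (not_le.1 h)]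
  have hBC : B * C ≤ 0 := by
    have hk3 : 0 < k₃ ^ 2 := by positivity
    by_contra h
    nlinarith [mul_nonneg_of_nonpos_of_nonpos e₃₁ e₃₂, mul_pos hk3 (not_le.1 h)]
  have hB0 : B ≠ 0 := by
    rintro rfl
    simp at e₂₃
  have : 0 < B ^ 2 := by positivity
  nlinarith [mul_nonneg_of_nonpos_of_nonpos hAB hBC, mul_neg_of_neg_of_pos hAC this]

/-- Otherwise the combination `x` lies on `Γ`, and every `l j` of nonzero weight lies on the
supporting line at `x`. That line meets `Γ` in at most one point besides `x`, so `x` is a real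
multiple in `[0, 1]` of some `l k ≠ x`, against the visibility of `l k`. -/
theorem norm_lt_one_of_convex_combination (hΦ : Differentiable ℂ Φ) (h0 : ‖Φ 0‖ < 1)
    (hconv : IsStrictlyConvexArc Γ) (hinf : Γ.Infinite)
    (hsub : Γ ⊆ Φ ⁻¹' Metric.sphere (0 : ℂ) 1)
    (hhull : convexHull ℝ (Γ ∪ {0}) \ Γ ⊆ Φ ⁻¹' Metric.ball (0 : ℂ) 1)
    {J : Type*} [Fintype J] {l : J → ℂ} (hinj : Function.Injective l)
    (hl : ∀ j, l j ∈ visiblePoints Γ) {w : J → ℝ} (hw0 : ∀ j, 0 ≤ w j) (hw1 : ∑ j, w j ≤ 1)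
    (hw : ∀ j, w j < 1) : ‖Φ (∑ j, w j * l j)‖ < 1 := by
  set x := ∑ j, w j * l j with hx
  by_contra hlt
  have hxK : x ∈ convexHull ℝ (Γ ∪ {0}) := by
    have := (convex_convexHull ℝ (Γ ∪ {0})).sum_mem (t := Finset.univ)
      (w := fun o : Option J => o.elim (1 - ∑ j, w j) w) (z := fun o => o.elim 0 l)
      (fun o _ => by cases o <;> simp [hw0, hw1]) (by simp [Fintype.sum_option])
      (fun o _ => subset_convexHull ℝ _ (by cases o <;> simp [(hl _).1]))
    simpa [Fintype.sum_option] using this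
  have hxΓ : x ∈ Γ := by
    by_contra hxΓ
    exact hlt (by simpa using hhull ⟨hxK, hxΓ⟩)
  obtain ⟨f, hf, hmax⟩ := exists_supporting_functional hΦ h0 (convex_convexHull ℝ _)
    (hconv.interior_nonempty hinf) (fun z => norm_le_one_of_mem_convexHull hsub hhull)
    (x := x) (by simpa using hsub hxΓ)
  have hfx : f x = ∑ j, w j * f (l j) := by
    rw [hx, map_sum]
    exact Finset.sum_congr rfl fun j _ => by simpa using f.map_smul (w j) (l j)
  have hfx0 : 0 ≤ f x := by simpa using hmax 0 (subset_convexHull ℝ _ (by simp))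
  have hfl : ∀ j, f (l j) ≤ f x := fun j => hmax _ (subset_convexHull ℝ _ (by simp [(hl j).1]))
  have hS : ∀ j, w j ≠ 0 → f (l j) = f x := by
    have hnn : ∀ j ∈ Finset.univ, 0 ≤ w j * (f x - f (l j)) := fun j _ =>
      mul_nonneg (hw0 j) (sub_nonneg.2 (hfl j))
    have hsum : ∑ j, w j * (f x - f (l j)) = 0 := by
      refine le_antisymm ?_ (Finset.sum_nonneg hnn)
      simp only [mul_sub, Finset.sum_sub_distrib, ← Finset.sum_mul, ← hfx]
      nlinarith
    intro j hj
    have := (Finset.sum_eq_zero_iff_of_nonneg hnn).1 hsum j (Finset.mem_univ j)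
    rcases mul_eq_zero.1 this with h | h
    · exact absurd h hj
    · linarith
  have hthree : ∀ a ∈ Γ, ∀ b ∈ Γ, ∀ c ∈ Γ, f a = f x → f b = f x → f c = f x → a ≠ b → a ≠ c →
      b = c := by
    intro a ha b hb c hc hfa hfb hfc hab hac
    by_contra hbc
    refine hconv.not_collinear ha hb hc hab hac hbc (collinear_of_apply_eq hf (r := f x) ?_)
    rintro z (rfl | rfl | rfl) <;> assumption
  -- a point `l k` with positive weight that is different from `x`
  have hk : ∃ k, w k ≠ 0 ∧ l k ≠ x := by
    by_contra! hall
    have hsum : x = (∑ j, w j : ℝ) * x := by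
      conv_lhs => rw [hx]
      rw [Complex.ofReal_sum, Finset.sum_mul]
      refine Finset.sum_congr rfl fun j _ => ?_
      by_cases hj : w j = 0
      · simp [hj]
      · rw [hall j hj]
    have hx0 : x ≠ 0 := fun h => hlt (by rwa [h])
    have hone : ∑ j, w j = 1 := by
      have := mul_right_cancel₀ hx0 ((one_mul x).trans hsum)
      exact_mod_cast this.symm
    obtain ⟨k, -, hk⟩ := Finset.exists_ne_zero_of_sum_ne_zero (hone.trans_ne one_ne_zero)
    rw [Finset.sum_eq_single k (fun j _ hjk => ?_) (by simp)] at hone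
    · exact (hw k).ne hone
    · by_contra hj
      exact hjk (hinj ((hall j hj).trans (hall k hk).symm))
  obtain ⟨k, hwk, hkx⟩ := hk
  have hother : ∀ j, w j ≠ 0 → j ≠ k → l j = x := fun j hj hjk =>
    hthree (l k) (hl k).1 (l j) (hl j).1 x hxΓ (hS k hwk) (hS j hj) rfl
      (fun h => hjk (hinj h).symm) hkx
  classical
  set s := ∑ j ∈ Finset.univ.erase k, w j with hs
  have hxs : x = w k * l k + s * x := by
    conv_lhs => rw [hx, ← Finset.add_sum_erase _ _ (Finset.mem_univ k)]
    rw [hs, Complex.ofReal_sum, Finset.sum_mul]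
    congr 1
    refine Finset.sum_congr rfl fun j hj => ?_
    by_cases hj0 : w j = 0
    · simp [hj0]
    · rw [hother j hj0 (Finset.ne_of_mem_erase hj)]
  have hsk : w k + s ≤ 1 := by
    rw [hs, Finset.add_sum_erase _ _ (Finset.mem_univ k)]
    exact hw1
  have hwk' : 0 < w k := (hw0 k).lt_of_ne hwk.symm
  have hs1 : 0 < 1 - s := by linarith
  have hxt : ((w k / (1 - s) : ℝ) : ℂ) * l k = x := by
    have : ((1 - s : ℝ) : ℂ) ≠ 0 := by exact_mod_cast hs1.ne'
    push_cast at this ⊢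
    field_simp
    linear_combination -hxs
  rcases ((div_le_one hs1).2 (by linarith : w k ≤ 1 - s)).lt_or_eq with h | h
  · exact (hl k).2 _ (by positivity) h (hxt ▸ hxΓ)
  · rw [h] at hxt
    exact hkx (by simpa using hxt)

/-- An infinite bounded subset of `Γ` whose nontrivial convex combinations (with the origin) are
mapped by `Φ` into the open unit disc. -/
theorem exists_infinite_isBounded_subset (hΦ : Differentiable ℂ Φ) (h0 : ‖Φ 0‖ < 1)
    (harc : IsNontrivialArc Γ) (hconv : IsStrictlyConvexArc Γ)
    (hsub : Γ ⊆ Φ ⁻¹' Metric.sphere (0 : ℂ) 1)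
    (hhull : convexHull ℝ (Γ ∪ {0}) \ Γ ⊆ Φ ⁻¹' Metric.ball (0 : ℂ) 1) :
    ∃ S : Set ℂ, S.Infinite ∧ Bornology.IsBounded S ∧ (∀ l ∈ S, ‖Φ l‖ = 1) ∧
      ∀ J : Finset ℂ, (J : Set ℂ) ⊆ S → ∀ w : J → ℝ, (∀ j, 0 ≤ w j) → ∑ j, w j ≤ 1 →
        (∀ j, w j < 1) → ‖Φ (∑ j, w j * (j : ℂ))‖ < 1 := by
  obtain ⟨⟨p, hp, q, hq, hpq⟩, I, γ, hI, hγ, rfl⟩ := harc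
  obtain ⟨a, ha, rfl⟩ := hp
  obtain ⟨b, hb, rfl⟩ := hq
  -- `Γ` may be unbounded; a compact subarc gives a bounded set that is still infinite.
  have hsubI : Set.uIcc a b ⊆ I := hI.uIcc_subset ha hb
  have hcont := hγ.mono hsubI
  have hinf' : (γ '' Set.uIcc a b).Infinite :=
    (isPreconnected_uIcc.image γ hcont).infinite_of_nontrivial
      ⟨γ a, ⟨a, Set.left_mem_uIcc, rfl⟩, γ b, ⟨b, Set.right_mem_uIcc, rfl⟩, hpq⟩
  have hss := Set.image_mono (f := γ) hsubI
  have hinf := hinf'.mono hss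
  have hfin := finite_diff_visiblePoints hΦ h0 hconv hinf hsub hhull
  refine ⟨γ '' Set.uIcc a b ∩ visiblePoints (γ '' I), ?_, ?_, ?_, fun J hJ w hw0 hw1 hw => ?_⟩
  · refine (hinf'.sdiff hfin).mono fun x hx => ⟨hx.1, ?_⟩
    by_contra hn
    exact hx.2 ⟨hss hx.1, hn⟩
  · exact (isCompact_uIcc.image_of_continuousOn hcont).isBounded.subset Set.inter_subset_left
  · intro l hl
    simpa using hsub (hss hl.1)
  · exact norm_lt_one_of_convex_combination hΦ h0 hconv hinf hsub hhull
      Subtype.val_injective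
      (fun j => (hJ j.2).2) hw0 hw1 hw

end Arc

/-! ### Perturbing the frequencies -/

theorem exists_gt_one_norm_near {Φ : ℂ → ℂ} (hΦ : Differentiable ℂ Φ) (h0 : ‖Φ 0‖ < 1) {x : ℂ}
    (hx : ‖Φ x‖ = 1) {r : ℝ} (hr : 0 < r) : ∃ y, dist y x < r ∧ 1 < ‖Φ y‖ := by
  by_contra! h
  exact not_eventually_norm_le_one hΦ h0 hx (Metric.eventually_nhds_iff.2 ⟨r, hr, fun _ => h _⟩)

theorem sum_option_elim_eq {J : Finset ℂ} {m d : ℕ} (p : Fin d → Option J) :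
    ∑ i, (p i).elim 0 (fun j => (j : ℂ) / m) =
      ∑ j : J, (((Finset.univ.filter fun i => p i = some j).card / m : ℝ) : ℂ) * j := by
  classical
  have h : ∀ i, (p i).elim 0 (fun j => (j : ℂ) / m) =
      ∑ j : J, if p i = some j then (j : ℂ) / m else 0 := by
    intro i
    cases h : p i <;> simp
  simp_rw [h]
  rw [Finset.sum_comm]
  refine Finset.sum_congr rfl fun j _ => ?_
  rw [← Finset.sum_filter, Finset.sum_const, nsmul_eq_mul]
  push_cast
  ring

/-- A sum of at most `m` terms from `0` and the `j / m` is a combination with weights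
(multiplicity)`/m`, all below `1` unless one `j` is taken `m` times. There are finitely many such
sums and `|Φ| < 1` is an open condition, so a common tolerance exists, within which each `j` can be
moved to where `|Φ| > 1`. -/
theorem exists_perturbation {Φ : ℂ → ℂ} (hΦ : Differentiable ℂ Φ) (h0 : ‖Φ 0‖ < 1)
    {J : Finset ℂ} (hJ : ∀ j ∈ J, ‖Φ j‖ = 1)
    (hcomb : ∀ w : J → ℝ, (∀ j, 0 ≤ w j) → ∑ j, w j ≤ 1 → (∀ j, w j < 1) →
      ‖Φ (∑ j, w j * (j : ℂ))‖ < 1)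
    {m : ℕ} (hm : 0 < m) {N : Set (J → ℂ)} (hN : N ∈ 𝓝 fun j : J => (j : ℂ)) :
    ∃ l ∈ N, (∀ j, 1 < ‖Φ (l j)‖) ∧ ∃ δ > 0, ∀ d ≤ m, ∀ (z : Fin d → ℂ) (p : Fin d → Option J),
      (∀ i, p i = none → ‖z i‖ < δ) → (∀ i j, p i = some j → z i = l j / m) →
      (d = m → ∀ j, ∃ i, p i ≠ some j) → ‖Φ (∑ i, z i)‖ < 1 := by
  classical
  have hm' : (0 : ℝ) < m := by exact_mod_cast hm
  have key : ∀ d : Fin (m + 1), ∀ p : Fin d → Option J, (d = m → ∀ j, ∃ i, p i ≠ some j) →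
      ∀ᶠ η in 𝓝[>] (0 : ℝ), ∀ z : Fin d → ℂ,
        (∀ i, dist (z i) ((p i).elim 0 (fun j => (j : ℂ) / m)) < η) → ‖Φ (∑ i, z i)‖ < 1 := by
    intro d p hp
    have hlt : ‖Φ (∑ i, (p i).elim 0 (fun j => (j : ℂ) / m))‖ < 1 := by
      rw [sum_option_elim_eq]
      refine hcomb _ (fun j => by positivity) ?_ fun j => ?_
      · rw [← Finset.sum_div, div_le_one hm', ← Nat.cast_sum, Nat.cast_le]
        calc ∑ j : J, (Finset.univ.filter fun i => p i = some j).card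
            = ∑ i, ∑ j : J, if p i = some j then 1 else 0 := by
              rw [Finset.sum_comm]; simp
          _ ≤ ∑ i : Fin d, 1 := by
              refine Finset.sum_le_sum fun i _ => ?_
              cases p i <;> simp
          _ ≤ m := by simpa using Nat.lt_succ_iff.1 d.2
      · rw [div_lt_one hm', Nat.cast_lt]
        by_cases hd : (d : ℕ) = m
        · obtain ⟨i, hi⟩ := hp hd j
          refine (Finset.card_lt_card (Finset.filter_ssubset.2 ⟨i, Finset.mem_univ i, hi⟩)).trans_le ?_
          simp [hd]
        · refine (Finset.card_filter_le _ _).trans_lt ?_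
          have := d.2
          simp
          omega
    have hopen : IsOpen {z : Fin d → ℂ | ‖Φ (∑ i, z i)‖ < 1} :=
      isOpen_lt (hΦ.continuous.comp (by fun_prop)).norm continuous_const
    obtain ⟨η, hη, hsub⟩ := Metric.isOpen_iff.1 hopen _ hlt
    filter_upwards [Ioo_mem_nhdsGT hη] with η' hη' z hz
    exact hsub (Metric.mem_ball.2 ((dist_pi_lt_iff hη).2 fun i => (hz i).trans hη'.2))
  have key2 := eventually_all.2 fun d => eventually_all.2 fun p =>
    eventually_imp_distrib_left.2 (key d p)
  obtain ⟨η, hη, hηpos⟩ := (key2.and self_mem_nhdsWithin).exists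
  obtain ⟨r, hr, hrN⟩ := Metric.mem_nhds_iff.1 hN
  choose l hl1 hl2 using fun j : J =>
    exists_gt_one_norm_near hΦ h0 (hJ j j.2) (lt_min hr hηpos)
  refine ⟨l, hrN (Metric.mem_ball.2 ((dist_pi_lt_iff hr).2 fun j =>
    (hl1 j).trans_le (min_le_left _ _))), hl2, η, hηpos, fun d hd z p hz1 hz2 hp => ?_⟩
  refine hη ⟨d, Nat.lt_succ_iff.2 hd⟩ p hp z fun i => ?_
  cases h : p i with
  | none => simpa using hz1 i h
  | some j =>
    rw [hz2 i j h, Option.elim_some, dist_eq_norm, ← sub_div, norm_div, Complex.norm_natCast]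
    refine (div_le_self (norm_nonneg _) (by exact_mod_cast hm)).trans_lt ?_
    rw [← dist_eq_norm]
    exact (hl1 j).trans_le (min_le_right _ _)

/-! ### Monomials and their leading exponent -/

theorem exists_fin_enumeration (α : ℕ →₀ ℕ) : ∃ idx : Fin α.degree → ℕ,
    (∀ f : ℕ → entireFunctions, α.prod (fun i n => f i ^ n) = ∏ k, f (idx k)) ∧
    ∀ x : ℕ → ℝ, α.sum (fun i n => n * x i) = ∑ k, x (idx k) := by
  obtain ⟨L, hL⟩ := Quot.exists_rep (Finsupp.toMultiset α)
  have hL' : (L : Multiset ℕ) = Finsupp.toMultiset α := hL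
  have hlen : L.length = α.degree := by
    rw [← Multiset.coe_card, hL', Finsupp.card_toMultiset]
    rfl
  rw [← hlen]
  refine ⟨L.get, fun f => ?_, fun x => ?_⟩
  · have : (Multiset.map f (Finsupp.toMultiset α)).prod = ∏ k, f (L.get k) := by
      rw [← hL', Multiset.map_coe, Multiset.prod_coe]
      simp [← List.prod_ofFn, List.ofFn_getElem_eq_map]
    rw [← this, Finsupp.toMultiset_map, Finsupp.prod_toMultiset,
      Finsupp.prod_mapDomain_index (by simp) (by simp [pow_add])]
  · have : (Multiset.map x (Finsupp.toMultiset α)).sum = ∑ k, x (L.get k) := by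
      rw [← hL', Multiset.map_coe, Multiset.sum_coe]
      simp [← List.sum_ofFn, List.ofFn_getElem_eq_map]
    rw [← this, Finsupp.toMultiset_map, Finsupp.sum_toMultiset,
      Finsupp.sum_mapDomain_index (by simp) (by simp [add_mul])]
    simp

/-- The weights are `t ^ i` with `t` transcendental: two exponents of equal weight would make `t` a
root of a nonzero integer polynomial. Among the exponents of maximal degree take the one of least
weight, then rescale its weight to `1`. -/
theorem exists_leading_exponent {A : Finset (ℕ →₀ ℕ)} (hA : A.Nonempty) (h0 : 0 ∉ A) :
    ∃ β ∈ A, ∃ x : ℕ → ℝ, (∀ i, 0 < x i) ∧ β.sum (fun i n => n * x i) = 1 ∧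
      ∀ α ∈ A, α.degree ≤ β.degree ∧
        (α.degree = β.degree → α ≠ β → 1 < α.sum fun i n => n * x i) := by
  classical
  obtain ⟨t, ht0, ht⟩ : ∃ t : ℝ, 0 < t ∧ Transcendental ℤ t := by
    have h := transcendental_liouvilleNumber (m := 2) le_rfl
    refine ⟨_, ?_, h⟩
    exact (LiouvilleNumber.summable (by norm_num)).tsum_pos (fun i => by positivity) 0 (by positivity)
  let wt : (ℕ →₀ ℕ) → ℝ := fun α => α.sum fun i n => n * t ^ i
  have hinj : Function.Injective wt := by
    intro α β h
    let P : (ℕ →₀ ℕ) → Polynomial ℤ := fun α => α.sum fun i n => Polynomial.monomial i (n : ℤ)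
    have hP : ∀ α, Polynomial.aeval t (P α) = wt α := by
      intro α
      simp [P, wt, Finsupp.sum, Polynomial.aeval_monomial]
    have hz : Polynomial.aeval t (P α - P β) = 0 := by rw [map_sub, hP, hP, h, sub_self]
    have h2 : P α - P β = 0 := by
      by_contra hne
      exact ht ⟨_, hne, hz⟩
    have hcoeff : ∀ α i, (P α).coeff i = α i := by
      intro α i
      simp only [P, Finsupp.sum, Polynomial.finsetSum_coeff, Polynomial.coeff_monomial]
      rw [Finset.sum_ite_eq']
      by_cases hi : i ∈ α.support <;> simp_all
    ext i
    have := congrArg (fun p => Polynomial.coeff p i) (sub_eq_zero.1 h2)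
    simp only [hcoeff] at this
    exact_mod_cast this
  obtain ⟨γ, hγ, hmax⟩ := A.exists_max_image Finsupp.degree hA
  obtain ⟨β, hβ, hmin⟩ := (A.filter fun α => α.degree = γ.degree).exists_min_image wt
    ⟨γ, by simp [hγ]⟩
  obtain ⟨hβA, hβγ⟩ := Finset.mem_filter.1 hβ
  have hpos : 0 < wt β := by
    obtain ⟨i, hi⟩ := Finsupp.support_nonempty_iff.2 fun h : β = 0 => h0 (h ▸ hβA)
    refine Finset.sum_pos (fun i hi => ?_) ⟨i, hi⟩
    have : 0 < β i := Nat.pos_of_ne_zero (Finsupp.mem_support_iff.1 hi)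
    positivity
  have hdiv : ∀ α : ℕ →₀ ℕ, α.sum (fun i n => n * (t ^ i / wt β)) = wt α / wt β := by
    intro α
    simp only [wt, Finsupp.sum, Finset.sum_div, mul_div_assoc]
  refine ⟨β, hβA, fun i => t ^ i / wt β, fun i => by positivity, ?_, fun α hα =>
    ⟨hβγ ▸ hmax α hα, fun hd hne => ?_⟩⟩
  · rw [hdiv, div_self hpos.ne']
  · rw [hdiv, one_lt_div hpos]
    exact (hmin α (by simp [hα, hd, hβγ])).lt_of_ne fun h => hne (hinj h.symm)

/-! ### Limits of iterates on products of perturbed sums -/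

theorem iterate_smul_expFun {Φ : ℂ → ℂ} (hΦ : IsEntireOfExponentialType Φ) (q : ℕ) (c l : ℂ) :
    ((convolutionLinearMap Φ hΦ) ^ q) (c • expFun l) = (c * Φ l ^ q) • expFun l := by
  induction q with
  | zero => simp
  | succ q ih =>
    rw [pow_succ', Module.End.mul_apply, ih, map_smul]
    change _ • convolutionOperator Φ (expFun l) = _
    rw [convolutionOperator_expFun hΦ, smul_smul, pow_succ, mul_assoc]

theorem tendsto_smul_expFun {a : ℕ → ℂ} {b : ℂ} (l : ℂ) (h : Tendsto a atTop (𝓝 b)) :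
    Tendsto (fun q => a q • expFun l) atTop (𝓝 (b • expFun l)) :=
  h.smul_const _

/-- Images under `Φ(D)^q` of products of exponential sums with convergent coefficients. -/
theorem pow_convolution_prod_sum {Φ : ℂ → ℂ} (hΦ : IsEntireOfExponentialType Φ) {κ : Type*}
    [DecidableEq κ] {d : ℕ} (s : Fin d → Finset κ) (c : Fin d → κ → ℂ) (μ : κ → ℂ) (q : ℕ) :
    ((convolutionLinearMap Φ hΦ) ^ q) (∏ i, ∑ k ∈ s i, c i k • expFun (μ k)) =
      ∑ x ∈ Fintype.piFinset s,
        ((∏ i, c i (x i)) * Φ (∑ i, μ (x i)) ^ q) • expFun (∑ i, μ (x i)) := by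
  rw [Finset.prod_univ_sum, map_sum]
  refine Finset.sum_congr rfl fun x _ => ?_
  rw [← iterate_smul_expFun hΦ, expFun_sum]
  congr 1
  simp only [← Finset.prod_smul]

section Limit

variable {Φ : ℂ → ℂ} (hΦ : IsEntireOfExponentialType Φ) {J : Finset ℂ} {m : ℕ} (l : J → ℂ)
  (a : J → ℂ) (x : ℕ → ℝ) (u : ℕ → ℂ →₀ ℂ)

/-- Exponents of the perturbed exponential sums. -/
noncomputable def perturbedExponent (m : ℕ) (l : J → ℂ) : ℂ ⊕ J → ℂ :=
  Sum.elim id fun j => l j / m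

/-- Coefficients of the perturbed exponential sums. -/
noncomputable def perturbedCoeff (Φ : ℂ → ℂ) (l a : J → ℂ) (x : ℕ → ℝ) (u : ℕ → ℂ →₀ ℂ) (q i : ℕ) :
    ℂ ⊕ J → ℂ :=
  Sum.elim (u i) fun j => a j * Complex.exp (-(x i) * Complex.log (Φ (l j))) ^ q

/-- The exponential sums `u i`, perturbed by exponentials with small coefficients. -/
noncomputable def perturbedSum (Φ : ℂ → ℂ) (m : ℕ) (l a : J → ℂ) (x : ℕ → ℝ) (u : ℕ → ℂ →₀ ℂ)
    (q i : ℕ) : entireFunctions :=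
  ∑ k ∈ (u i).support.disjSum Finset.univ,
    perturbedCoeff Φ l a x u q i k • expFun (perturbedExponent m l k)

theorem tendsto_perturbedCoeff (hl : ∀ j, 1 < ‖Φ (l j)‖) {i : ℕ} (hx : 0 < x i) (k : ℂ ⊕ J) :
    Tendsto (fun q => perturbedCoeff Φ l a x u q i k) atTop
      (𝓝 (Sum.elim (u i) (fun _ => 0) k)) := by
  rcases k with γ | j
  · exact tendsto_const_nhds
  · have h : ‖Complex.exp (-(x i) * Complex.log (Φ (l j)))‖ < 1 := by
      rw [Complex.norm_exp, Real.exp_lt_one_iff]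
      have := Real.log_pos (hl j)
      simp [Complex.log_re]
      positivity
    simpa [perturbedCoeff] using (tendsto_pow_atTop_nhds_zero_of_norm_lt_one h).const_mul (a j)

theorem tendsto_perturbedSum (hl : ∀ j, 1 < ‖Φ (l j)‖) {i : ℕ} (hx : 0 < x i) :
    Tendsto (fun q => perturbedSum Φ m l a x u q i) atTop
      (𝓝 ((u i).sum fun γ c => c • expFun γ)) := by
  have h := tendsto_finsetSum ((u i).support.disjSum Finset.univ) fun k _ =>
    tendsto_smul_expFun (perturbedExponent m l k) (tendsto_perturbedCoeff l a x u hl hx k)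
  simpa [perturbedSum, Finset.sum_disjSum, perturbedExponent, Finsupp.sum] using h

variable {l a x u}

theorem tendsto_mixed_coeff (hl : ∀ j, 1 < ‖Φ (l j)‖) (hx : ∀ i, 0 < x i) {d : ℕ}
    (idx : Fin d → ℕ) (y : Fin d → ℂ ⊕ J)
    (hy : ‖Φ (∑ i, perturbedExponent m l (y i))‖ < 1) :
    Tendsto (fun q => (∏ i, perturbedCoeff Φ l a x u q (idx i) (y i)) *
      Φ (∑ i, perturbedExponent m l (y i)) ^ q) atTop (𝓝 0) := by
  have h := (tendsto_finsetProd Finset.univ fun i _ =>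
    tendsto_perturbedCoeff l a x u hl (hx (idx i)) (y i)).mul
    (tendsto_pow_atTop_nhds_zero_of_norm_lt_one hy)
  simpa using h

/-- The frequencies add up to `m · (l j / m) = l j`, so the eigenvalue `Φ (l j) ^ q` competes with
the damping factors, which are powers of `Φ (l j)` taken through one fixed logarithm. -/
theorem pure_coeff_eq (hl : ∀ j, 1 < ‖Φ (l j)‖) (hm : 0 < m) (idx : Fin m → ℕ) (j : J) (q : ℕ) :
    (∏ i, perturbedCoeff Φ l a x u q (idx i) (Sum.inr j)) *
      Φ (∑ _i : Fin m, perturbedExponent m l (Sum.inr j)) ^ q =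
    a j ^ m * Complex.exp ((1 - ∑ i, x (idx i) : ℝ) * Complex.log (Φ (l j))) ^ q := by
  have hm' : (m : ℂ) ≠ 0 := by exact_mod_cast hm.ne'
  have h1 : ∑ _i : Fin m, perturbedExponent m l (Sum.inr j) = l j := by
    simp [perturbedExponent]
    field_simp
  have h2 : Φ (l j) ≠ 0 := fun h => by
    have := hl j
    rw [h, norm_zero] at this
    linarith
  obtain ⟨L, hL⟩ : ∃ L, L = Complex.log (Φ (l j)) := ⟨_, rfl⟩
  have h3 : Φ (l j) = Complex.exp L := by rw [hL, Complex.exp_log h2]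
  rw [h1]
  simp only [perturbedCoeff, Sum.elim_inr, Finset.prod_mul_distrib, Finset.prod_const,
    Finset.card_univ, Fintype.card_fin, Finset.prod_pow, ← Complex.exp_sum, ← hL]
  rw [h3]
  rw [mul_assoc, ← mul_pow, ← Complex.exp_add]
  congr 3
  rw [← Finset.sum_mul]
  push_cast
  rw [Finset.sum_neg_distrib]
  ring

/-- Mixed terms decay through their eigenvalue; a pure term, possible only for `d = m`, decays
because total weight above `1` overdamps it. -/
theorem tendsto_pow_prod_zero (hl : ∀ j, 1 < ‖Φ (l j)‖) (hx : ∀ i, 0 < x i) (hm : 0 < m)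
    {S : Set ℂ} (hu : ∀ i, ((u i).support : Set ℂ) ⊆ S) {d : ℕ}
    (hmix : ∀ y : Fin d → ℂ ⊕ J, (∀ i γ, y i = Sum.inl γ → γ ∈ S) →
      (d = m → ∀ j, ∃ i, y i ≠ Sum.inr j) → ‖Φ (∑ i, perturbedExponent m l (y i))‖ < 1)
    (idx : Fin d → ℕ) (hidx : d = m → 1 < ∑ i, x (idx i)) :
    Tendsto (fun q => ((convolutionLinearMap Φ hΦ) ^ q) (∏ i, perturbedSum Φ m l a x u q (idx i)))
      atTop (𝓝 0) := by
  classical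
  simp only [perturbedSum, pow_convolution_prod_sum]
  rw [← Finset.sum_const_zero (s := Fintype.piFinset fun i =>
    (u (idx i)).support.disjSum (Finset.univ : Finset J))]
  refine tendsto_finsetSum _ fun y hy => ?_
  rw [← zero_smul ℂ (expFun (∑ i, perturbedExponent m l (y i)))]
  refine tendsto_smul_expFun _ ?_
  by_cases hpure : d = m → ∀ j, ∃ i, y i ≠ Sum.inr j
  · refine tendsto_mixed_coeff hl hx idx y (hmix y (fun i γ hγ => hu (idx i) ?_) hpure)
    have := Fintype.mem_piFinset.1 hy i
    rw [hγ] at this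
    simpa using this
  · push Not at hpure
    obtain ⟨rfl, j, hj⟩ := hpure
    obtain rfl : y = fun _ => Sum.inr j := funext hj
    simp only [pure_coeff_eq hl hm]
    have h : ‖Complex.exp ((1 - ∑ i, x (idx i) : ℝ) * Complex.log (Φ (l j)))‖ < 1 := by
      rw [Complex.norm_exp, Real.exp_lt_one_iff, Complex.re_ofReal_mul, Complex.log_re]
      exact mul_neg_of_neg_of_pos (by linarith [hidx rfl]) (Real.log_pos (hl j))
    simpa using (tendsto_pow_atTop_nhds_zero_of_norm_lt_one h).const_mul (a j ^ d)

/-- At total weight exactly `1` damping and growth cancel, so pure terms do not depend on `q` and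
only they survive. -/
theorem tendsto_pow_prod_leading (hl : ∀ j, 1 < ‖Φ (l j)‖) (hx : ∀ i, 0 < x i) (hm : 0 < m)
    {S : Set ℂ} (hu : ∀ i, ((u i).support : Set ℂ) ⊆ S)
    (hmix : ∀ y : Fin m → ℂ ⊕ J, (∀ i γ, y i = Sum.inl γ → γ ∈ S) →
      (∀ j, ∃ i, y i ≠ Sum.inr j) → ‖Φ (∑ i, perturbedExponent m l (y i))‖ < 1)
    (idx : Fin m → ℕ) (hidx : ∑ i, x (idx i) = 1) :
    Tendsto (fun q => ((convolutionLinearMap Φ hΦ) ^ q) (∏ i, perturbedSum Φ m l a x u q (idx i)))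
      atTop (𝓝 (∑ j, a j ^ m • expFun (l j))) := by
  classical
  simp only [perturbedSum, pow_convolution_prod_sum]
  have hlim : ∑ j, a j ^ m • expFun (l j) =
      ∑ y ∈ Fintype.piFinset fun i => (u (idx i)).support.disjSum (Finset.univ : Finset J),
        ∑ j, if y = (fun _ => Sum.inr j) then a j ^ m • expFun (l j) else 0 := by
    rw [Finset.sum_comm]
    refine Finset.sum_congr rfl fun j _ => ?_
    rw [Finset.sum_ite_eq', if_pos]
    simp
  rw [hlim]
  refine tendsto_finsetSum _ fun y hy => ?_
  by_cases hpure : ∀ j, ∃ i, y i ≠ Sum.inr j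
  · rw [Finset.sum_eq_zero fun j _ => if_neg fun h => ?_]
    · rw [← zero_smul ℂ (expFun (∑ i, perturbedExponent m l (y i)))]
      refine tendsto_smul_expFun _ (tendsto_mixed_coeff hl hx idx y
        (hmix y (fun i γ hγ => hu (idx i) ?_) hpure))
      have := Fintype.mem_piFinset.1 hy i
      rw [hγ] at this
      simpa using this
    · obtain ⟨i, hi⟩ := hpure j
      exact hi (congrFun h i)
  · push Not at hpure
    obtain ⟨j, hj⟩ := hpure
    obtain rfl : y = fun _ => Sum.inr j := funext hj
    rw [Finset.sum_eq_single j, if_pos rfl]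
    · simp only [pure_coeff_eq hl hm, hidx]
      have h1 : ∑ _i : Fin m, perturbedExponent m l (Sum.inr j) = l j := by
        have hm' : (m : ℂ) ≠ 0 := by exact_mod_cast hm.ne'
        simp [perturbedExponent]
        field_simp
      rw [h1]
      simp
    · intro k _ hk
      refine if_neg fun h => hk ?_
      have := congrFun h ⟨0, hm⟩
      simpa using this.symm
    · simp

end Limit

/-! ### Transitivity -/

theorem mem_span_expFun_iff {S : Set ℂ} {f : entireFunctions} :
    f ∈ Submodule.span ℂ (expFun '' S) ↔
      ∃ c : ℂ →₀ ℂ, (c.support : Set ℂ) ⊆ S ∧ c.sum (fun l a => a • expFun l) = f := by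
  rw [Finsupp.mem_span_image_iff_linearCombination]
  simp only [Finsupp.mem_supported, Finsupp.linearCombination_apply]

/-- The transitivity property behind the existence of hypercyclic algebras. -/
theorem exists_mem_pow_monomials_mem {Φ : ℂ → ℂ} (hΦ : IsEntireOfExponentialType Φ)
    (h0 : ‖Φ 0‖ < 1) {S : Set ℂ} (hS : S.Infinite) (hSb : Bornology.IsBounded S)
    (hS1 : ∀ l ∈ S, ‖Φ l‖ = 1)
    (hcomb : ∀ J : Finset ℂ, (J : Set ℂ) ⊆ S → ∀ w : J → ℝ, (∀ j, 0 ≤ w j) → ∑ j, w j ≤ 1 →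
        (∀ j, w j < 1) → ‖Φ (∑ j, w j * (j : ℂ))‖ < 1)
    {A : Finset (ℕ →₀ ℕ)} {β : A} (hβ0 : β.1 ≠ 0) {x : ℕ → ℝ} (hx : ∀ i, 0 < x i)
    (hβ : β.1.sum (fun i n => n * x i) = 1)
    (hA : ∀ α ∈ A, α.degree ≤ β.1.degree ∧
        (α.degree = β.1.degree → α ≠ β → 1 < α.sum fun i n => n * x i))
    {U : Set (ℕ → entireFunctions)} (hU : IsOpen U) (hUne : U.Nonempty)
    {Ω : Set (A → entireFunctions)} (hΩ : IsOpen Ω) {v : entireFunctions}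
    (hv : Pi.single β v ∈ Ω) :
    ∃ f ∈ U, ∃ q : ℕ, (fun α : A =>
      ((convolutionLinearMap Φ hΦ) ^ q) (α.1.prod fun i n => f i ^ n)) ∈ Ω := by
  classical
  set m := β.1.degree with hmdef
  have hm : 0 < m := Nat.pos_of_ne_zero fun h =>
    hβ0 ((Finsupp.degree_eq_zero_iff _).1 h)
  have hm' : (m : ℂ) ≠ 0 := by exact_mod_cast hm.ne'
  -- By density the target may be taken to be an exponential sum with frequencies in `S`.
  obtain ⟨v, hv, hvs⟩ := (dense_span_expFun hS hSb).inter_open_nonempty _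
    (hΩ.preimage (continuous_single β)) ⟨v, hv⟩
  obtain ⟨b, hbS, rfl⟩ := mem_span_expFun_iff.1 hvs
  set J := b.support with hJ
  have hcont : Continuous fun l : J → ℂ =>
      (Pi.single β (∑ j : J, b j • expFun (l j)) : A → entireFunctions) :=
    (continuous_single β).comp (continuous_finsetSum _ fun j _ =>
      (continuous_expFun.comp (continuous_apply j)).const_smul (b j))
  obtain ⟨l, hlN, hl, δ, hδ, hpert⟩ := exists_perturbation hΦ.1 h0 (J := J)
    (fun j hj => hS1 j (hbS hj)) (hcomb J hbS) hm
    ((hΩ.preimage hcont).mem_nhds (x := fun j : J => (j : ℂ)) (by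
      change Pi.single β (∑ j : J, b j • expFun j) ∈ Ω
      rw [Finset.sum_coe_sort J fun j => b j • expFun j]
      exact hv))
  -- The frequencies of `u` are kept below `δ`, so that mixed sums of frequencies remain where `|Φ|
  -- < 1`.
  have hballinf : (Metric.ball (0 : ℂ) δ).Infinite :=
    infinite_of_mem_nhds 0 (Metric.ball_mem_nhds 0 hδ)
  obtain ⟨u₀, hu₀U, hu₀⟩ := (dense_pi Set.univ fun (_ : ℕ) _ =>
    dense_span_expFun hballinf Metric.isBounded_ball).inter_open_nonempty U hU hUne
  choose u huS hu using fun i => mem_span_expFun_iff.1 (hu₀ i (Set.mem_univ i))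
  choose a ha using fun j : J => IsAlgClosed.exists_pow_nat_eq (b j) hm
  have hmix : ∀ d ≤ m, ∀ y : Fin d → ℂ ⊕ J, (∀ i γ, y i = Sum.inl γ → γ ∈ Metric.ball (0 : ℂ) δ) →
      (d = m → ∀ j, ∃ i, y i ≠ Sum.inr j) → ‖Φ (∑ i, perturbedExponent m l (y i))‖ < 1 := by
    intro d hd y hy hne
    refine hpert d hd _ (fun i => (y i).getRight?) (fun i hi => ?_) (fun i j hj => ?_)
      fun h j => ?_
    · rcases h : y i with γ | j
      · simpa [perturbedExponent] using hy i γ h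
      · simp [h] at hi
    · rw [Sum.getRight?_eq_some_iff] at hj
      simp [hj, perturbedExponent]
    · obtain ⟨i, hi⟩ := hne h j
      exact ⟨i, fun h => hi (Sum.getRight?_eq_some_iff.1 h)⟩
  have hf : Tendsto (fun q i => perturbedSum Φ m l a x u q i) atTop (𝓝 u₀) :=
    tendsto_pi_nhds.2 fun i => by
      rw [← hu i]
      exact tendsto_perturbedSum l a x u hl (hx i)
  have hT : Tendsto (fun q => fun α : A => ((convolutionLinearMap Φ hΦ) ^ q)
      (α.1.prod fun i n => perturbedSum Φ m l a x u q i ^ n)) atTop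
      (𝓝 (Pi.single β (∑ j : J, b j • expFun (l j)))) := by
    refine tendsto_pi_nhds.2 fun α => ?_
    obtain ⟨idx, hprod, hsum⟩ := exists_fin_enumeration α.1
    simp only [hprod]
    by_cases hαβ : α = β
    · subst hαβ
      simp only [Pi.single_eq_same, ← ha]
      exact tendsto_pow_prod_leading hΦ hl hx hm huS
        (fun y h1 h2 => hmix m le_rfl y h1 fun _ => h2) idx (by rw [← hsum, hβ])
    · rw [Pi.single_eq_of_ne hαβ]
      obtain ⟨hle, hlt⟩ := hA α α.2
      refine tendsto_pow_prod_zero hΦ hl hx hm huS (hmix _ hle) idx fun h => ?_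
      rw [← hsum]
      exact hlt h fun h => hαβ (Subtype.ext h)
  obtain ⟨q, hqU, hqΩ⟩ := ((hf.eventually_mem (hU.mem_nhds hu₀U)).and
    (hT.eventually_mem (hΩ.mem_nhds hlN))).exists
  exact ⟨_, hqU, q, hqΩ⟩

/-! ### Free generators -/

theorem exists_mvPolynomial_of_mem_adjoin {X : Type*} [CommRing X] [Algebra ℂ X] {f : ℕ → X} {a : X}
    (ha : a ∈ NonUnitalAlgebra.adjoin ℂ (Set.range f)) :
    ∃ P : MvPolynomial ℕ ℂ, MvPolynomial.constantCoeff P = 0 ∧ MvPolynomial.aeval f P = a := by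
  induction ha using NonUnitalAlgebra.adjoin_induction with
  | mem a ha =>
    obtain ⟨n, rfl⟩ := ha
    exact ⟨MvPolynomial.X n, by simp, by simp⟩
  | add a b _ _ iha ihb =>
    obtain ⟨P, hP, rfl⟩ := iha
    obtain ⟨Q, hQ, rfl⟩ := ihb
    exact ⟨P + Q, by simp [hP, hQ], by simp⟩
  | zero => exact ⟨0, by simp, by simp⟩
  | mul a b _ _ iha ihb =>
    obtain ⟨P, hP, rfl⟩ := iha
    obtain ⟨Q, hQ, rfl⟩ := ihb
    exact ⟨P * Q, by simp [hP], by simp⟩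
  | smul c a _ iha =>
    obtain ⟨P, hP, rfl⟩ := iha
    exact ⟨c • P, by simp [MvPolynomial.smul_eq_C_mul, hP], by simp⟩

/-- Each element of the algebra comes from a unique polynomial without constant term. Evaluating it
at `g` in the unitization of `B` gives zero scalar part, hence an element of `B`. -/
theorem isSetOfFreeGenerators_range {X : Type u} [CommRing X] [Algebra ℂ X] {f : ℕ → X}
    (hf : ∀ P : MvPolynomial ℕ ℂ, P ≠ 0 → MvPolynomial.constantCoeff P = 0 →
      MvPolynomial.aeval f P ≠ 0) :
    IsSetOfFreeGenerators (Set.range fun n : ℕ =>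
      (⟨f n, NonUnitalAlgebra.subset_adjoin ℂ ⟨n, rfl⟩⟩ :
        NonUnitalAlgebra.adjoin ℂ (Set.range f))) := by
  intro B _ _ _ _ g
  set A := NonUnitalAlgebra.adjoin ℂ (Set.range f)
  let gen : ℕ → A := fun n => ⟨f n, NonUnitalAlgebra.subset_adjoin ℂ ⟨n, rfl⟩⟩
  let ev : MvPolynomial ℕ ℂ →ₐ[ℂ] Unitization ℂ B :=
    MvPolynomial.aeval fun n => (Unitization.inr (g ⟨gen n, n, rfl⟩) : Unitization ℂ B)
  have hfst : ∀ P, (ev P).fst = MvPolynomial.constantCoeff P := by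
    intro P
    have : (Unitization.fstHom ℂ B).comp ev = MvPolynomial.aeval fun _ => (0 : ℂ) :=
      MvPolynomial.algHom_ext fun n => by simp [ev]
    have h2 := DFunLike.congr_fun this P
    rw [MvPolynomial.aeval_zero'] at h2
    simpa using h2
  choose P hP0 hP using fun a : A => exists_mvPolynomial_of_mem_adjoin a.2
  have huniq : ∀ (a : A) (Q : MvPolynomial ℕ ℂ), MvPolynomial.constantCoeff Q = 0 →
      MvPolynomial.aeval f Q = a.1 → P a = Q := by
    intro a Q hQ0 hQ
    by_contra hne
    exact hf (P a - Q) (sub_ne_zero.2 hne) (by simp [hP0, hQ0]) (by simp [hP, hQ])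
  let φ : A →ₙₐ[ℂ] B :=
    { toFun := fun a => (ev (P a)).snd
      map_smul' := fun c a => by
        rw [huniq (c • a) (c • P a) ?_ (by simp [hP])]
        · simp
        · simp [MvPolynomial.smul_eq_C_mul, hP0]
      map_zero' := by
        rw [huniq 0 0 (by simp) (by simp)]
        simp
      map_add' := fun a b => by
        rw [huniq (a + b) (P a + P b) (by simp [hP0]) (by simp [hP])]
        simp
      map_mul' := fun a b => by
        rw [huniq (a * b) (P a * P b) (by simp [hP0]) (by simp [hP])]
        simp [hfst, hP0] }
  have hφ : ∀ n, φ (gen n) = g ⟨gen n, n, rfl⟩ := by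
    intro n
    change (ev (P (gen n))).snd = _
    rw [huniq (gen n) (MvPolynomial.X n) (by simp) (by simp [gen])]
    simp [ev]
  refine ⟨φ, ?_, fun ψ hψ => ?_⟩
  · rintro ⟨_, n, rfl⟩
    exact hφ n
  · ext ⟨a, ha⟩
    induction ha using NonUnitalAlgebra.adjoin_induction with
    | mem a ha =>
      obtain ⟨n, rfl⟩ := ha
      exact (hψ ⟨gen n, n, rfl⟩).trans (hφ n).symm
    | add a b ha hb iha ihb =>
      have : (⟨a + b, add_mem ha hb⟩ : A) = ⟨a, ha⟩ + ⟨b, hb⟩ := rfl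
      rw [this, map_add, map_add, iha, ihb]
    | zero => exact (map_zero ψ).trans (map_zero φ).symm
    | mul a b ha hb iha ihb =>
      have : (⟨a * b, mul_mem ha hb⟩ : A) = ⟨a, ha⟩ * ⟨b, hb⟩ := rfl
      rw [this, map_mul, map_mul, iha, ihb]
    | smul c a ha iha =>
      have : (⟨c • a, SMulMemClass.smul_mem c ha⟩ : A) = c • ⟨a, ha⟩ := rfl
      rw [this, map_smul, map_smul, iha]

theorem isDenselyStronglyAlgebrable_of_aeval_mem {X : Type u} [CommRing X] [Algebra ℂ X]
    [TopologicalSpace X] {E : Set X} {f : ℕ → X} (hd : Dense (Set.range f))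
    (hE : ∀ P : MvPolynomial ℕ ℂ, P ≠ 0 → MvPolynomial.constantCoeff P = 0 →
      MvPolynomial.aeval f P ∈ E)
    (hf : ∀ P : MvPolynomial ℕ ℂ, P ≠ 0 → MvPolynomial.constantCoeff P = 0 →
      MvPolynomial.aeval f P ≠ 0) : IsDenselyStronglyAlgebrable E := by
  refine ⟨_, ?_, NonUnitalAlgebra.adjoin ℂ (Set.range f), fun a ha => ?_,
    hd.mono (NonUnitalAlgebra.subset_adjoin ℂ), _, rfl, isSetOfFreeGenerators_range hf⟩
  · rw [Cardinal.aleph0_le_mk_iff]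
    refine Set.infinite_coe_iff.2 (Set.infinite_range_of_injective fun i j h => ?_)
    by_contra hij
    have h1 : f i = f j := congrArg Subtype.val h
    refine hf (MvPolynomial.X i - MvPolynomial.X j) (sub_ne_zero.2 fun h => ?_) (by simp)
      (by simp [h1])
    exact hij (MvPolynomial.X_injective h)
  · obtain ⟨P, hP0, rfl⟩ := exists_mvPolynomial_of_mem_adjoin ha
    by_cases hP : P = 0
    · exact Or.inr (by simp [hP])
    · exact Or.inl (hE P hP hP0)

theorem IsDenselyStronglyAlgebrable.mono {X : Type u} [NonUnitalCommRing X] [Module ℂ X]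
    [TopologicalSpace X] {E F : Set X} (h : IsDenselyStronglyAlgebrable E) (hEF : E ⊆ F) :
    IsDenselyStronglyAlgebrable F := by
  obtain ⟨κ, hκ, A, hA, h⟩ := h
  exact ⟨κ, hκ, A, hA.trans (Set.union_subset_union_left _ hEF), h⟩

/-! ### Baire category argument -/

/-- In the product topology, altering one coordinate far enough out is a small change. -/
theorem dense_setOf_exists_mem {X : Type*} [TopologicalSpace X] {V : Set X} (hV : V.Nonempty) :
    Dense {f : ℕ → X | ∃ k, f k ∈ V} := by
  obtain ⟨v, hv⟩ := hV
  refine dense_iff_inter_open.2 fun U hU ⟨f, hf⟩ => ?_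
  have h : Tendsto (fun k => Function.update f k v) atTop (𝓝 f) :=
    tendsto_pi_nhds.2 fun i => tendsto_const_nhds.congr' <| by
      filter_upwards [eventually_gt_atTop i] with k hk
      rw [Function.update_of_ne hk.ne]
  obtain ⟨k, hk⟩ := (h.eventually_mem (hU.mem_nhds hf)).exists
  exact ⟨_, hk, k, by simpa using hv⟩

theorem aeval_eq_sum_coeff_smul (f : ℕ → entireFunctions) (P : MvPolynomial ℕ ℂ) :
    MvPolynomial.aeval f P =
      ∑ α : P.support, P.coeff α.1 • α.1.prod fun i n => f i ^ n := by
  rw [Finset.sum_coe_sort P.support fun α => P.coeff α • α.prod fun i n => f i ^ n,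
    MvPolynomial.aeval_def, MvPolynomial.eval₂_eq]
  exact Finset.sum_congr rfl fun α _ => (Algebra.smul_def _ _).symm

theorem IsHypercyclicVector.ne_zero {Φ : ℂ → ℂ} (hΦ : IsEntireOfExponentialType Φ)
    {f : entireFunctions} (hf : IsHypercyclicVector (convolutionOperator Φ) f) : f ≠ 0 := by
  rintro rfl
  have h : Set.range (fun n : ℕ => (convolutionOperator Φ)^[n] 0) ⊆ {0} := by
    rintro _ ⟨n, rfl⟩
    exact Function.iterate_fixed (map_zero (convolutionLinearMap Φ hΦ)) n
  have h1 := (hf.mono h).closure_eq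
  rw [closure_singleton] at h1
  have h2 : (1 : entireFunctions) ∈ ({0} : Set entireFunctions) := h1 ▸ Set.mem_univ _
  have h3 := congrArg (fun f : entireFunctions => f.1 0) (Set.mem_singleton_iff.1 h2)
  exact one_ne_zero (α := ℂ) h3

/-- Countably many operators, finite exponent sets and basic open sets give countably many dense
open conditions. At least one operator is needed here, since freeness is deduced from hypercyclic
vectors being nonzero. -/
theorem isDenselyStronglyAlgebrable_of_nonempty {ι : Type*} [Countable ι] [Nonempty ι]
    (Φ : ι → ℂ → ℂ) (hΦ : ∀ i, IsEntireOfExponentialType (Φ i))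
    (h0 : ∀ i, Φ i 0 ∈ Metric.ball (0 : ℂ) 1)
    (hΓ : ∀ i, ∃ Γ : Set ℂ, IsNontrivialArc Γ ∧ IsStrictlyConvexArc Γ ∧
        Γ ⊆ Φ i ⁻¹' Metric.sphere (0 : ℂ) 1 ∧
        convexHull ℝ (Γ ∪ {0}) \ Γ ⊆ Φ i ⁻¹' Metric.ball (0 : ℂ) 1) :
    IsDenselyStronglyAlgebrable
      (commonHypercyclicVectors fun i => convolutionOperator (Φ i)) := by
  classical
  have h0' : ∀ i, ‖Φ i 0‖ < 1 := fun i => by simpa using h0 i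
  choose β hβA x hx hβ hlead using
    fun A : {A : Finset (ℕ →₀ ℕ) // A.Nonempty ∧ 0 ∉ A} => exists_leading_exponent A.2.1 A.2.2
  let T : ∀ i, entireFunctions →ₗ[ℂ] entireFunctions := fun i => convolutionLinearMap (Φ i) (hΦ i)
  have hTc : ∀ i q, Continuous fun y => (T i ^ q) y := fun i q => by
    simp only [Module.End.coe_pow]
    exact (continuous_convolutionLinearMap (hΦ i)).iterate q
  have hres1 : ∀ᶠ f in residual (ℕ → entireFunctions),
      ∀ V ∈ TopologicalSpace.countableBasis entireFunctions, ∃ k, f k ∈ V := by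
    rw [eventually_countable_ball (TopologicalSpace.countable_countableBasis _)]
    intro V hV
    refine residual_of_dense_open ?_ (dense_setOf_exists_mem
      (TopologicalSpace.nonempty_of_mem_countableBasis hV))
    simp only [Set.ofPred_exists]
    exact isOpen_iUnion fun k =>
      (TopologicalSpace.isOpen_of_mem_countableBasis hV).preimage (continuous_apply k)
  have hres2 : ∀ᶠ f in residual (ℕ → entireFunctions),
      ∀ (i : ι) (A : {A : Finset (ℕ →₀ ℕ) // A.Nonempty ∧ 0 ∉ A}),
      ∀ Ω ∈ TopologicalSpace.countableBasis (A.1 → entireFunctions),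
      -- Only targets supported at the leading exponent are required; the other monomials are sent
      -- near `0`.
      (∃ v, Pi.single (⟨β A, hβA A⟩ : A.1) v ∈ Ω) →
      ∃ q : ℕ, (fun α : A.1 => (T i ^ q) (α.1.prod fun i n => f i ^ n)) ∈ Ω := by
    rw [eventually_countable_forall]
    intro i
    rw [eventually_countable_forall]
    intro A
    rw [eventually_countable_ball (TopologicalSpace.countable_countableBasis _)]
    intro Ω hΩ
    rw [eventually_imp_distrib_left]
    rintro ⟨v, hv⟩
    have hΩo := TopologicalSpace.isOpen_of_mem_countableBasis hΩ
    refine residual_of_dense_open ?_ (dense_iff_inter_open.2 fun U hU hUne => ?_)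
    · simp only [Set.ofPred_exists]
      refine isOpen_iUnion fun q => hΩo.preimage (continuous_pi fun α => (hTc i q).comp ?_)
      exact continuous_finsetProd _ fun n _ => (continuous_apply n).pow _
    · obtain ⟨Γ, harc, hconv, hsub, hhull⟩ := hΓ i
      obtain ⟨S, hS, hSb, hS1, hcomb⟩ :=
        exists_infinite_isBounded_subset (hΦ i).1 (h0' i) harc hconv hsub hhull
      exact exists_mem_pow_monomials_mem (hΦ i) (h0' i) hS hSb hS1 hcomb
        (β := ⟨β A, hβA A⟩) (ne_of_mem_of_not_mem (hβA A) A.2.2) (hx A) (hβ A) (hlead A) hU hUne hΩo hv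
  obtain ⟨f, hf1, hf2⟩ := (dense_of_mem_residual (hres1.and hres2)).nonempty
  have hhyp : ∀ P : MvPolynomial ℕ ℂ, P ≠ 0 → MvPolynomial.constantCoeff P = 0 →
      MvPolynomial.aeval f P ∈ commonHypercyclicVectors fun i => convolutionOperator (Φ i) := by
    intro P hP hP0 i
    refine dense_iff_inter_open.2 fun V hV ⟨v, hv⟩ => ?_
    let A : {A : Finset (ℕ →₀ ℕ) // A.Nonempty ∧ 0 ∉ A} :=
      ⟨P.support, by simpa using hP, by simpa [MvPolynomial.constantCoeff_eq] using hP0⟩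
    let b : A.1 := ⟨β A, hβA A⟩
    have hb : P.coeff b.1 ≠ 0 := MvPolynomial.mem_support_iff.1 b.2
    let L : (A.1 → entireFunctions) → entireFunctions := fun y => ∑ α, P.coeff α.1 • y α
    have hL : Continuous L :=
      continuous_finsetSum _ fun α _ => Continuous.const_smul (g := fun y : A.1 → entireFunctions => y α)
      (continuous_apply α) (P.coeff α.1)
    -- Dividing by the leading coefficient of `P` makes the combination of monomials approximate `v`
    -- itself.
    have hLb : L (Pi.single b ((P.coeff b.1)⁻¹ • v)) = v := by
      simp only [L]
      rw [Finset.sum_eq_single b]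
      · rw [Pi.single_eq_same, smul_smul, mul_inv_cancel₀ hb, one_smul]
      · intro α _ hα
        rw [Pi.single_eq_of_ne hα, smul_zero]
      · simp
    obtain ⟨Ω, hΩ, hmem, hsub⟩ :=
      (TopologicalSpace.isBasis_countableBasis _).exists_subset_of_mem_open
        (show Pi.single b ((P.coeff b.1)⁻¹ • v) ∈ L ⁻¹' V by rwa [Set.mem_preimage, hLb])
        (hV.preimage hL)
    obtain ⟨q, hq⟩ := hf2 i A Ω hΩ ⟨_, hmem⟩
    refine ⟨_, hsub hq, q, ?_⟩
    change (⇑(T i))^[q] _ = _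
    rw [← Module.End.coe_pow, aeval_eq_sum_coeff_smul, map_sum]
    exact Finset.sum_congr rfl fun α _ => map_smul _ _ _
  refine isDenselyStronglyAlgebrable_of_aeval_mem (f := f) ?_ hhyp fun P hP hP0 => ?_
  · refine (TopologicalSpace.isBasis_countableBasis _).dense_iff.2 fun V hV _ => ?_
    obtain ⟨k, hk⟩ := hf1 V hV
    exact ⟨f k, hk, k, rfl⟩
  · obtain ⟨i⟩ := ‹Nonempty ι›
    exact (hhyp P hP hP0 i).ne_zero (hΦ i)

/-! ### The operators `sin(kD)` -/

theorem convexOn_sinh : ConvexOn ℝ (Set.Ici 0) Real.sinh := by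
  refine convexOn_of_deriv2_nonneg (convex_Ici 0) Real.continuous_sinh.continuousOn
    Real.differentiable_sinh.differentiableOn ?_ fun y hy => ?_
  · rw [Real.deriv_sinh]
    exact Real.differentiable_cosh.differentiableOn
  · rw [interior_Ici] at hy
    simpa using (Set.mem_Ioi.1 hy).le

/-- The region below the arc `sinh y = cos x`, where `|sin| ≤ 1`. -/
def sinRegion : Set ℂ :=
  {z | z.re ∈ Set.Icc (-(Real.pi / 2)) (Real.pi / 2) ∧ 0 ≤ z.im ∧ Real.sinh z.im ≤ Real.cos z.re}

/-- The arc `sinh y = cos x`, where `|sin| = 1`. -/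
def sinArc : Set ℂ :=
  {z | z.re ∈ Set.Icc (-(Real.pi / 2)) (Real.pi / 2) ∧ 0 ≤ z.im ∧ Real.sinh z.im = Real.cos z.re}

theorem sinArc_subset_sinRegion : sinArc ⊆ sinRegion := fun _ hz => ⟨hz.1, hz.2.1, hz.2.2.le⟩

theorem norm_sin_sq (z : ℂ) :
    ‖Complex.sin z‖ ^ 2 = 1 + (Real.sinh z.im ^ 2 - Real.cos z.re ^ 2) := by
  have h : Complex.sin z = ((Real.sin z.re * Real.cosh z.im : ℝ) : ℂ) +
      ((Real.cos z.re * Real.sinh z.im : ℝ) : ℂ) * Complex.I := by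
    push_cast
    exact Complex.sin_eq z
  rw [h, ← Complex.normSq_eq_norm_sq, Complex.normSq_add_mul_I]
  have h1 := Real.cosh_sq z.im
  have h2 := Real.sin_sq_add_cos_sq z.re
  linear_combination Real.sin z.re ^ 2 * h1 + (1 + Real.sinh z.im ^ 2) * h2

theorem norm_sin_eq_one {z : ℂ} (hz : z ∈ sinArc) : ‖Complex.sin z‖ = 1 := by
  have h := norm_sin_sq z
  rw [hz.2.2, sub_self, add_zero] at h
  exact (pow_eq_one_iff_of_nonneg (norm_nonneg _) two_ne_zero).1 h

theorem norm_sin_lt_one {z : ℂ} (hz : z ∈ sinRegion) (hz' : z ∉ sinArc) : ‖Complex.sin z‖ < 1 := by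
  have h1 : Real.sinh z.im < Real.cos z.re := hz.2.2.lt_of_ne fun h => hz' ⟨hz.1, hz.2.1, h⟩
  have h2 := norm_sin_sq z
  have h3 := pow_lt_pow_left₀ h1 (Real.sinh_nonneg_iff.2 hz.2.1) two_ne_zero
  exact (sq_lt_one_iff₀ (norm_nonneg _)).1 (by linarith)

/-- `sinh` is convex on `[0, ∞)` and `cos` is concave on `[-π/2, π/2]`. -/
theorem convex_sinRegion : Convex ℝ sinRegion := by
  rintro a ⟨ha1, ha2, ha3⟩ b ⟨hb1, hb2, hb3⟩ s t hs ht hst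
  have h1 := convexOn_sinh.2 ha2 hb2 hs ht hst
  have h2 := strictConcaveOn_cos_Icc.concaveOn.2 ha1 hb1 hs ht hst
  refine ⟨?_, ?_, ?_⟩
  · simpa using convex_Icc _ _ ha1 hb1 hs ht hst
  · simp only [Complex.add_im, Complex.smul_im, smul_eq_mul]
    positivity
  · simp only [Complex.add_im, Complex.smul_im, Complex.add_re, Complex.smul_re, smul_eq_mul]
      at h1 h2 ⊢
    nlinarith [mul_le_mul_of_nonneg_left ha3 hs, mul_le_mul_of_nonneg_left hb3 ht]

/-- Distinct points of the arc have distinct real parts, so strict concavity of `cos` puts the open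
chord strictly below the arc. -/
theorem notMem_sinArc_of_mem_openSegment {a b z : ℂ} (ha : a ∈ sinArc) (hb : b ∈ sinArc)
    (hab : a ≠ b) (hz : z ∈ openSegment ℝ a b) : z ∉ sinArc := by
  obtain ⟨ha1, ha2, ha3⟩ := ha
  obtain ⟨hb1, hb2, hb3⟩ := hb
  obtain ⟨s, t, hs, ht, hst, rfl⟩ := hz
  rintro ⟨-, -, h⟩
  have hre : a.re ≠ b.re := fun hre =>
    hab (Complex.ext hre (Real.sinh_injective (by rw [ha3, hb3, hre])))
  have h1 := convexOn_sinh.2 ha2 hb2 hs.le ht.le hst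
  have h2 := strictConcaveOn_cos_Icc.2 ha1 hb1 hre hs ht hst
  simp only [Complex.add_im, Complex.smul_im, Complex.add_re, Complex.smul_re, smul_eq_mul]
    at h h1 h2
  rw [ha3, hb3] at h1
  linarith

theorem isStrictlyConvexArc_sinArc : IsStrictlyConvexArc sinArc := by
  rintro a ha b hb z ⟨hz, hzΓ⟩
  by_contra hne
  simp only [Set.mem_insert_iff, Set.mem_singleton_iff, not_or] at hne
  have hab : a ≠ b := by
    rintro rfl
    rw [segment_same] at hz
    exact hne.1 hz
  exact notMem_sinArc_of_mem_openSegment ha hb hab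
    (mem_openSegment_of_ne_left_right (Ne.symm hne.1) (Ne.symm hne.2) hz) hzΓ

theorem isNontrivialArc_sinArc : IsNontrivialArc sinArc := by
  have hpi := Real.pi_pos
  let γ : ℝ → ℂ := fun t => t + Real.arsinh (Real.cos t) * Complex.I
  have himg : γ '' Set.Icc (-(Real.pi / 2)) (Real.pi / 2) = sinArc := by
    ext z
    constructor
    · rintro ⟨t, ht, rfl⟩
      refine ⟨by simpa [γ] using ht, ?_, by simp [γ]⟩
      simpa [γ] using Real.cos_nonneg_of_mem_Icc ht
    · rintro ⟨h1, h2, h3⟩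
      refine ⟨z.re, h1, Complex.ext (by simp [γ]) ?_⟩
      simp [γ, ← h3]
  refine ⟨⟨γ 0, ?_, γ (Real.pi / 2), ?_, fun h => ?_⟩, _, γ, Set.ordConnected_Icc,
    (Complex.continuous_ofReal.add ((Complex.continuous_ofReal.comp
      (Real.continuous_arsinh.comp Real.continuous_cos)).mul continuous_const)).continuousOn, himg⟩
  · rw [← himg]
    exact Set.mem_image_of_mem _ ⟨by linarith, by linarith⟩
  · rw [← himg]
    exact Set.mem_image_of_mem _ ⟨by linarith, le_rfl⟩
  · have := congrArg Complex.re h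
    simp [γ] at this
    linarith

theorem isEntireOfExponentialType_sin_mul (k : ℂ) :
    IsEntireOfExponentialType fun z => Complex.sin (k * z) := by
  refine ⟨by fun_prop, 1, ‖k‖ + 1, one_pos, by positivity, fun n => ?_⟩
  have h : ‖iteratedDeriv n Complex.sin 0‖ ≤ 1 := by
    obtain ⟨m, rfl | rfl⟩ := Nat.even_or_odd' n
    · rw [Complex.iteratedDeriv_even_sin]
      simp
    · rw [Complex.iteratedDeriv_odd_sin]
      simp
  have h2 : iteratedDeriv n (fun z => Complex.sin (k * z)) 0 =
      k ^ n * iteratedDeriv n Complex.sin 0 := by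
    have := congrFun (iteratedDeriv_comp_const_mul (n := n) Complex.contDiff_sin k) 0
    simpa using this
  rw [taylorCoeff, h2, norm_div, Complex.norm_natCast, one_mul, norm_mul, norm_pow]
  gcongr
  calc ‖k‖ ^ n * ‖iteratedDeriv n Complex.sin 0‖ ≤ ‖k‖ ^ n * 1 := by gcongr
    _ ≤ (‖k‖ + 1) ^ n := by rw [mul_one]; gcongr; linarith

theorem isDenselyStronglyAlgebrable_sin :
    IsDenselyStronglyAlgebrable
      (commonHypercyclicVectors fun k : ℕ+ =>
        convolutionOperator fun z : ℂ => Complex.sin (((k : ℕ) : ℂ) * z)) := by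
  refine isDenselyStronglyAlgebrable_of_nonempty _ (fun k => isEntireOfExponentialType_sin_mul _)
    (fun k => by simp) fun k => ?_
  have hk : ((k : ℕ) : ℂ) ≠ 0 := by exact_mod_cast k.ne_zero
  -- The arc for `sin(kz)` is the one for `sin` scaled by `1 / k`; linearity preserves its convexity
  -- properties.
  let e : ℂ →ₗ[ℝ] ℂ := LinearMap.mulLeft ℝ ((k : ℕ) : ℂ)
  have he : Function.Injective e := mul_right_injective₀ hk
  refine ⟨e ⁻¹' sinArc, ⟨?_, ?_⟩, fun a ha b hb z hz => ?_, fun z hz => ?_, fun z hz => ?_⟩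
  · exact isNontrivialArc_sinArc.1.preimage (mul_left_surjective₀ hk)
  · obtain ⟨-, I, γ, hI, hγ, himg⟩ := isNontrivialArc_sinArc
    refine ⟨I, fun t => ((k : ℕ) : ℂ)⁻¹ * γ t, hI, continuousOn_const.mul hγ, ?_⟩
    rw [← himg]
    ext z
    constructor
    · rintro ⟨t, ht, rfl⟩
      exact ⟨t, ht, by simp [e, hk]⟩
    · rintro ⟨t, ht, h⟩
      exact ⟨t, ht, by simp [h, e, hk]⟩
  · have h := isStrictlyConvexArc_sinArc _ ha _ hb ⟨?_, hz.2⟩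
    · simpa [he.eq_iff] using h
    · exact image_segment ℝ e.toAffineMap a b ▸ Set.mem_image_of_mem e hz.1
  · exact mem_sphere_zero_iff_norm.2 (norm_sin_eq_one hz)
  · have hsub : convexHull ℝ (e ⁻¹' sinArc ∪ {0}) ⊆ e ⁻¹' sinRegion := by
      refine convexHull_min (Set.union_subset (Set.preimage_mono sinArc_subset_sinRegion) ?_)
        (convex_sinRegion.linear_preimage e)
      have := Real.pi_pos
      rintro z rfl
      simp [sinRegion]
      linarith
    exact mem_ball_zero_iff.2 (norm_sin_lt_one (hsub hz.1) hz.2)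

theorem mainTheorem3 :
    IsDenselyStronglyAlgebrable
      (commonHypercyclicVectors fun k : ℕ+ =>
        convolutionOperator fun z : ℂ => Complex.sin (((k : ℕ) : ℂ) * z)) ∧
    ∀ {ι : Type*} [Countable ι] (Φ : ι → ℂ → ℂ),
      (∀ i, IsEntireOfExponentialType (Φ i)) →
      (∀ i, Φ i 0 ∈ Metric.ball (0 : ℂ) 1) →
      (∀ i, ∃ Γ : Set ℂ, IsNontrivialArc Γ ∧ IsStrictlyConvexArc Γ ∧
        Γ ⊆ Φ i ⁻¹' Metric.sphere (0 : ℂ) 1 ∧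
        convexHull ℝ (Γ ∪ {0}) \ Γ ⊆ Φ i ⁻¹' Metric.ball (0 : ℂ) 1) →
      IsDenselyStronglyAlgebrable
        (commonHypercyclicVectors fun i => convolutionOperator (Φ i)) := by
  refine ⟨isDenselyStronglyAlgebrable_sin, fun {ι} _ Φ hΦ h0 hΓ => ?_⟩
  rcases isEmpty_or_nonempty ι with h | h
  -- For an empty family every vector is common hypercyclic, so the algebra found for the sines
  -- serves.
  · exact isDenselyStronglyAlgebrable_sin.mono fun _ _ i => h.elim i
  · exact isDenselyStronglyAlgebrable_of_nonempty Φ hΦ h0 hΓ
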